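/- Let $M$ be a smooth manifold, and equip $\mathbb TM=TM\oplus T^*M$ with the metric $g(X+\xi,Y+\eta)=\frac12(\xi(Y)+\eta(X))$. Let $\mathcal J$ be a smooth field of endomorphisms of $\mathbb TM$ with $\mathcal J^2=-\mathrm{Id}$ which is $g$-symmetric, respectively $g$-skew-symmetric, and let $D$ be a (smooth) linear connection on $M$. Let $\tau$ denote complex conjugation of $T^{\mathbb C}M$ in the symmetric case and the identity map in the skew-symmetric case. Suppose that the holomorphic bundle of $\mathcal J$ (the $i$-eigenbundle of its complex linear extension to $\mathbb T^{\mathbb C}M$) is $$L^\tau(E,\alpha)=\{X+\xi\;:\;X\in E,\ \xi\in (T^{\mathbb C}M)^*,\ \xi|_{\tau(E)}=\alpha(X,\cdot)\},$$ where $E\subset T^{\mathbb C}M$ is a smooth complex subbundle and $\alpha\in\Gamma(E^*\otimes\tau(E)^*)$ is a smooth complex bilinear form. The connection $D$ induces a connection on $\pi:T^*M\to M$ and hence a splitting $T(T^*M)=H^D\oplus T^{\mathrm{vert}}(T^*M)\cong\pi^*(TM\oplus T^*M)$ into horizontal and vertical subbundles. Let $J^{\mathcal J,D}:=\pi^*\mathcal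 J$ be the almost complex structure on the manifold $T^*M$ which corresponds to $\mathcal J$ under this identification. Then $J^{\mathcal J,D}$ is integrable (i.e. the sections of its $i$-eigenbundle in $T^{\mathbb C}(T^*M)$ are closed under the Lie bracket) if and only if the following three conditions hold: (i) $E$ is involutive, i.e. $[\Gamma(E),\Gamma(E)]\subset\Gamma(E)$; (ii) the complex linear extensions of $D$ and of its curvature $R^D$ satisfy $D_{\Gamma(E)}\Gamma(\tau(E))\subset\Gamma(\tau(E))$ and $R^D_{X,Y}W=0$ for all $X,Y\in\Gamma(E)$, $W\in\Gamma(\tau(E))$; (iii) for all $X,Y,Z\in\Gamma(E)$, $$(D_X\alpha)(Y,\tau(Z))-(D_Y\alpha)(X,\tau(Z))+\alpha(T^D_XY,\tau(Z))=0,$$ where $T^D_XY=D_XY-D_YX-[X,Y]$ is the torsion of $D$ and $(D_X\alpha)(Y,W)=X(\alpha(Y,W))-\alpha(D_XY,W)-\alpha(Y,D_XW)$. Here $\alpha$ is extended arbitrarily to a field of complex bilinear forms on $T^{\mathbb C}M$ and the equation is required for every such extension (when (i) and (ii) hold, its left-hand side does not depend on the extension). -/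

import Mathlib

open Bundle FiberBundle
open scoped Manifold ContDiff TensorProduct

noncomputable section

namespace CotangentGC

/-! ### Complexification of a real vector space -/

section Complexification

variable {W : Type*} [AddCommGroup W] [Module ℝ W]

/-- The real part `ℂ ⊗ W → W`. -/
def cre : ℂ ⊗[ℝ] W →ₗ[ℝ] W :=
  (TensorProduct.lid ℝ W).toLinearMap ∘ₗ LinearMap.rTensor W Complex.reLm

/-- The imaginary part `ℂ ⊗ W → W`. -/
def cim : ℂ ⊗[ℝ] W →ₗ[ℝ] W :=
  (TensorProduct.lid ℝ W).toLinearMap ∘ₗ LinearMap.rTensor W Complex.imLm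

/-- The element `a + i b` of `ℂ ⊗ W`. -/
def cmk (a b : W) : ℂ ⊗[ℝ] W := (1 : ℂ) ⊗ₜ[ℝ] a + Complex.I ⊗ₜ[ℝ] b

@[simp] theorem cre_tmul (z : ℂ) (w : W) : cre (z ⊗ₜ[ℝ] w) = z.re • w := by simp [cre]

@[simp] theorem cim_tmul (z : ℂ) (w : W) : cim (z ⊗ₜ[ℝ] w) = z.im • w := by simp [cim]

@[simp] theorem cre_cmk (a b : W) : cre (cmk a b) = a := by simp [cmk]

@[simp] theorem cim_cmk (a b : W) : cim (cmk a b) = b := by simp [cmk]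

theorem cmk_cre_cim (z : ℂ ⊗[ℝ] W) : cmk (cre z) (cim z) = z := by
  induction z with
  | zero => simp [cmk]
  | tmul z w =>
    rw [cmk, cre_tmul, cim_tmul, ← TensorProduct.smul_tmul, ← TensorProduct.smul_tmul,
      ← TensorProduct.add_tmul]
    congr 1
    apply Complex.ext <;> simp
  | add x y hx hy =>
    conv_rhs => rw [← hx, ← hy]
    simp only [cmk, map_add, TensorProduct.tmul_add]
    abel

/-- The antilinear conjugation of `ℂ ⊗ W` with respect to the real form `W`. -/
def cconj : ℂ ⊗[ℝ] W →ₛₗ[starRingEnd ℂ] ℂ ⊗[ℝ] W where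
  toFun := LinearMap.rTensor W Complex.conjAe.toLinearMap
  map_add' := map_add _
  map_smul' := by
    intro c z
    induction z with
    | zero => simp
    | tmul z w => simp [TensorProduct.smul_tmul']
    | add x y hx hy => rw [smul_add, map_add, hx, hy, map_add, smul_add]

/-- The two kinds of compatibility of a generalized complex structure with the canonical metric. -/
inductive Parity
  | symmetric
  | skew

/-- The map `τ`: the standard conjugation in the symmetric case, the identity in the skew-symmetric
case. -/
def tau : Parity → ℂ ⊗[ℝ] W → ℂ ⊗[ℝ] W
  | .symmetric => fun z => cconj z
  | .skew => fun z => z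

/-- The complex subspace `τ(E)`. -/
def tauImage : Parity → Submodule ℂ (ℂ ⊗[ℝ] W) → Submodule ℂ (ℂ ⊗[ℝ] W)
  | .symmetric => fun E => E.map cconj
  | .skew => fun E => E

theorem tau_mem_tauImage (t : Parity) {E : Submodule ℂ (ℂ ⊗[ℝ] W)} {z : ℂ ⊗[ℝ] W}
    (hz : z ∈ E) : tau t z ∈ tauImage t E := by
  cases t
  · exact Submodule.mem_map_of_mem hz
  · exact hz

/-- The holomorphic space (`i`-eigenspace of the complex linear extension) of an endomorphism. -/
def holomorphicSpace (J : W →ₗ[ℝ] W) : Submodule ℂ (ℂ ⊗[ℝ] W) :=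
  Module.End.eigenspace (J.baseChange ℂ) Complex.I

end Complexification

/-! ### Complex vector fields and complex distributions on a manifold -/

section ComplexFields

variable {V : Type*} [NormedAddCommGroup V] [NormedSpace ℝ V]
  {H : Type*} [TopologicalSpace H] (I : ModelWithCorners ℝ V H)
  {M : Type*} [TopologicalSpace M] [ChartedSpace H M]

/-- The fibre at `x` of the complexified tangent bundle. -/
abbrev ComplexTangentSpace (x : M) : Type _ := ℂ ⊗[ℝ] TangentSpace I x

/-- A complex vector field is smooth on `U` if its real and imaginary parts are. -/
def SmoothOn [IsManifold I 1 M] (Z : Π x : M, ComplexTangentSpace I x) (U : Set M) : Prop :=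
  ContMDiffOn I I.tangent ∞ (fun x => (⟨x, cre (Z x)⟩ : TangentBundle I M)) U ∧
  ContMDiffOn I I.tangent ∞ (fun x => (⟨x, cim (Z x)⟩ : TangentBundle I M)) U

/-- `Z` is a (global) smooth section of the complex distribution `E`. -/
structure IsSection [IsManifold I 1 M] (E : Π x : M, Submodule ℂ (ComplexTangentSpace I x))
    (Z : Π x : M, ComplexTangentSpace I x) : Prop where
  smooth : SmoothOn I Z Set.univ
  mem : ∀ x, Z x ∈ E x

/-- `E` is a smooth complex subbundle of the complexified tangent bundle: near every point it is
spanned by a smooth frame. -/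
def IsSubbundle [IsManifold I 1 M] (E : Π x : M, Submodule ℂ (ComplexTangentSpace I x)) : Prop :=
  ∀ x₀ : M, ∃ U : Set M, IsOpen U ∧ x₀ ∈ U ∧
    ∃ (r : ℕ) (Z : Fin r → Π x : M, ComplexTangentSpace I x),
      (∀ i, SmoothOn I (Z i) U) ∧
      ∀ x ∈ U, LinearIndependent ℂ (fun i => Z i x) ∧
        Submodule.span ℂ (Set.range fun i => Z i x) = E x

/-- The complex bilinear extension of the Lie bracket of vector fields. -/
def lieBracket (Z W : Π x : M, ComplexTangentSpace I x) (x : M) : ComplexTangentSpace I x :=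
  cmk
    (VectorField.mlieBracket I (fun y => cre (Z y)) (fun y => cre (W y)) x
      - VectorField.mlieBracket I (fun y => cim (Z y)) (fun y => cim (W y)) x)
    (VectorField.mlieBracket I (fun y => cre (Z y)) (fun y => cim (W y)) x
      + VectorField.mlieBracket I (fun y => cim (Z y)) (fun y => cre (W y)) x)

/-- `E` is involutive: `[Γ(E), Γ(E)] ⊆ Γ(E)`. -/
def IsInvolutive [IsManifold I 1 M] (E : Π x : M, Submodule ℂ (ComplexTangentSpace I x)) : Prop :=
  ∀ Z W : Π x : M, ComplexTangentSpace I x, IsSection I E Z → IsSection I E W →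
    ∀ x, lieBracket I Z W x ∈ E x

/-- An almost complex structure is integrable if its holomorphic bundle is involutive. -/
def IsIntegrable [IsManifold I 1 M] (J : Π x : M, TangentSpace I x →ₗ[ℝ] TangentSpace I x) :
    Prop :=
  IsInvolutive I fun x => holomorphicSpace (J x)

variable {I}

/-- The derivative `Z(f)` of a complex valued function along a complex vector field. -/
def fieldDeriv (Z : Π x : M, ComplexTangentSpace I x) (f : M → ℂ) (x : M) : ℂ :=
  mvfderiv I f x (cre (Z x)) + Complex.I * mvfderiv I f x (cim (Z x))

variable [IsManifold I 1 M] (D : CovariantDerivative I V (TangentSpace I : M → Type _))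

/-- The complex linear extension `D_Z W` of a linear connection. -/
def cov (Z W : Π x : M, ComplexTangentSpace I x) (x : M) : ComplexTangentSpace I x :=
  cmk
    (D (fun y => cre (W y)) x (cre (Z x)) - D (fun y => cim (W y)) x (cim (Z x)))
    (D (fun y => cim (W y)) x (cre (Z x)) + D (fun y => cre (W y)) x (cim (Z x)))

/-- The torsion `T^D_X Y = D_X Y - D_Y X - [X, Y]`. -/
def torsion (X Y : Π x : M, ComplexTangentSpace I x) (x : M) : ComplexTangentSpace I x :=
  cov D X Y x - cov D Y X x - lieBracket I X Y x

/-- The curvature `R^D_{X,Y} W = - D_X D_Y W + D_Y D_X W + D_{[X,Y]} W`. -/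
def curvature (X Y W : Π x : M, ComplexTangentSpace I x) (x : M) : ComplexTangentSpace I x :=
  - cov D X (cov D Y W) x + cov D Y (cov D X W) x + cov D (lieBracket I X Y) W x

/-- The covariant derivative of a field `A` of complex bilinear forms:
`(D_X A)(Y, W) = X(A(Y, W)) - A(D_X Y, W) - A(Y, D_X W)`. -/
def covForm (A : Π x : M, ComplexTangentSpace I x →ₗ[ℂ] ComplexTangentSpace I x →ₗ[ℂ] ℂ)
    (X Y W : Π x : M, ComplexTangentSpace I x) (x : M) : ℂ :=
  fieldDeriv X (fun y => A y (Y y) (W y)) x - A x (cov D X Y x) (W x) - A x (Y x) (cov D X W x)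

end ComplexFields

/-! ### Generalized complex structures -/

section Generalized

variable {V : Type*} [NormedAddCommGroup V] [NormedSpace ℝ V]
  {H : Type*} [TopologicalSpace H] (I : ModelWithCorners ℝ V H)
  {M : Type*} [TopologicalSpace M] [ChartedSpace H M]

/-- The cotangent space at `x`. -/
abbrev CotangentSpace (x : M) : Type _ := TangentSpace I x →L[ℝ] ℝ

/-- The fibre at `x` of the generalized tangent bundle `TM ⊕ T*M`. -/
abbrev GenTangentSpace (x : M) : Type _ := TangentSpace I x × CotangentSpace I x

variable {I}

/-- The canonical metric of neutral signature, `g(X + ξ, Y + η) = (ξ(Y) + η(X)) / 2`. -/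
def canonicalMetric {x : M} (u v : GenTangentSpace I x) : ℝ := (1 / 2) * (u.2 v.1 + v.2 u.1)

/-- `𝒥` is a symmetric, respectively skew-symmetric, generalized complex structure on `M`:
a smooth field of endomorphisms of `TM ⊕ T*M` with `𝒥² = -Id` that is symmetric, respectively
skew-symmetric, with respect to the canonical metric. -/
structure IsGenComplex [IsManifold I 1 M] (t : Parity)
    (𝒥 : Π x : M, GenTangentSpace I x →L[ℝ] GenTangentSpace I x) : Prop where
  smooth : ContMDiff I (I.prod 𝓘(ℝ, (V × (V →L[ℝ] ℝ)) →L[ℝ] (V × (V →L[ℝ] ℝ)))) ∞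
    (fun x : M => (⟨x, 𝒥 x⟩ : TotalSpace ((V × (V →L[ℝ] ℝ)) →L[ℝ] (V × (V →L[ℝ] ℝ)))
      (fun x : M =>
        ((TangentSpace I : M → Type _) ×ᵇ (fun x : M => CotangentSpace I x)) x →L[ℝ]
        ((TangentSpace I : M → Type _) ×ᵇ (fun x : M => CotangentSpace I x)) x)))
  sq : ∀ (x : M) (u : GenTangentSpace I x), 𝒥 x (𝒥 x u) = -u
  compat : ∀ (x : M) (u v : GenTangentSpace I x),
    match t with
    | .symmetric => canonicalMetric (𝒥 x u) v = canonicalMetric u (𝒥 x v)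
    | .skew => canonicalMetric (𝒥 x u) v = -canonicalMetric u (𝒥 x v)

/-- The complex bilinear pairing of `ξ ∈ (T*_x M)^ℂ = (T_x M^ℂ)*` with `z ∈ T_x M^ℂ`. -/
def pairing {x : M} (ξ : ℂ ⊗[ℝ] CotangentSpace I x) (z : ComplexTangentSpace I x) : ℂ :=
  Module.Dual.baseChange ℂ (cre ξ : CotangentSpace I x).toLinearMap z
    + Complex.I * Module.Dual.baseChange ℂ (cim ξ : CotangentSpace I x).toLinearMap z

/-- The subset `L^τ(E, α) = {X + ξ : X ∈ E, ξ|_{τ(E)} = i_X α}` of `(T_x M ⊕ T*_x M)^ℂ`, for a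
complex subspace `E` of `T_x M^ℂ` and `α ∈ E* ⊗ τ(E)*`. -/
def Ltau (t : Parity) {x : M} (E : Submodule ℂ (ComplexTangentSpace I x))
    (α : E →ₗ[ℂ] tauImage t E →ₗ[ℂ] ℂ) : Set (ℂ ⊗[ℝ] GenTangentSpace I x) :=
  {l | ∃ h : (LinearMap.fst ℝ (TangentSpace I x) (CotangentSpace I x)).baseChange ℂ l ∈ E,
    ∀ W : tauImage t E,
      pairing ((LinearMap.snd ℝ (TangentSpace I x) (CotangentSpace I x)).baseChange ℂ l) W
        = α ⟨_, h⟩ W}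

/-- `α` is a smooth section of `E* ⊗ τ(E)*`: its values on smooth sections are smooth. -/
def IsSmoothForm [IsManifold I 1 M] (t : Parity)
    (E : Π x : M, Submodule ℂ (ComplexTangentSpace I x))
    (α : Π x : M, E x →ₗ[ℂ] tauImage t (E x) →ₗ[ℂ] ℂ) : Prop :=
  ∀ (Y W : Π x : M, ComplexTangentSpace I x) (hY : IsSection I E Y)
    (hW : IsSection I (fun x => tauImage t (E x)) W),
    ContMDiff I 𝓘(ℝ, ℂ) ∞ fun x => α x ⟨Y x, hY.mem x⟩ ⟨W x, hW.mem x⟩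

/-- The equation `(D_X α)(Y, τZ) - (D_Y α)(X, τZ) + α(T^D_X Y, τZ) = 0` for all sections `X, Y, Z`
of `E`. As `D_X Y`, `D_Y X` and `T^D_X Y` need not be sections of `E`, the three terms are formed
with an arbitrary extension `A` of `α` to a field of bilinear forms on the complexified tangent
bundle. -/
def TorsionEquation [IsManifold I 1 M] (t : Parity)
    (D : CovariantDerivative I V (TangentSpace I : M → Type _))
    (E : Π x : M, Submodule ℂ (ComplexTangentSpace I x))
    (α : Π x : M, E x →ₗ[ℂ] tauImage t (E x) →ₗ[ℂ] ℂ) : Prop :=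
  ∀ A : Π x : M, ComplexTangentSpace I x →ₗ[ℂ] ComplexTangentSpace I x →ₗ[ℂ] ℂ,
    (∀ (x : M) (X : E x) (W : tauImage t (E x)), A x X W = α x X W) →
    ∀ X Y Z : Π x : M, ComplexTangentSpace I x,
      IsSection I E X → IsSection I E Y → IsSection I E Z → ∀ x : M,
        covForm D A X Y (fun y => tau t (Z y)) x - covForm D A Y X (fun y => tau t (Z y)) x
          + A x (torsion D X Y x) (tau t (Z x)) = 0

end Generalized

/-! ### The cotangent manifold and its horizontal / vertical splitting -/

section Cotangent

variable {V : Type*} [NormedAddCommGroup V] [NormedSpace ℝ V]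
  {H : Type*} [TopologicalSpace H] (I : ModelWithCorners ℝ V H)
  (M : Type*) [TopologicalSpace M] [ChartedSpace H M]

/-- The cotangent manifold `T*M`. -/
abbrev CotangentBundle [IsManifold I 1 M] : Type _ :=
  TotalSpace (V →L[ℝ] ℝ) (fun x : M => CotangentSpace I x)

/-- The model with corners of the cotangent manifold. -/
abbrev cotModel : ModelWithCorners ℝ (V × (V →L[ℝ] ℝ)) (ModelProd H (V →L[ℝ] ℝ)) :=
  I.prod 𝓘(ℝ, V →L[ℝ] ℝ)

variable {I M} [IsManifold I ∞ M]

/-- A 1-form, as a map `M → T*M`. -/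
abbrev formSection (σ : Π x : M, CotangentSpace I x) : M → CotangentBundle I M :=
  fun x => ⟨x, σ x⟩

/-- Differentiability of a 1-form at a point. -/
abbrev FormDiffAt (σ : Π x : M, CotangentSpace I x) (x : M) : Prop :=
  MDifferentiableAt I (cotModel I) (formSection σ) x

theorem mdiff_apply {σ : Π x : M, CotangentSpace I x} {W : Π x : M, TangentSpace I x} {x : M}
    (hσ : FormDiffAt σ x) (hW : MDiffAt (T% W) x) :
    MDifferentiableAt I 𝓘(ℝ, ℝ) (fun y => σ y (W y)) x := by
  have : MDifferentiableAt I (I.prod 𝓘(ℝ, ℝ))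
      (fun m ↦ TotalSpace.mk' ℝ (E := Bundle.Trivial M ℝ) m (σ m (W m))) x := by
    apply MDifferentiableAt.clm_bundle_apply (F₁ := V) (F₂ := ℝ)
    · exact hσ
    · exact hW
  simp only [mdifferentiableAt_totalSpace] at this
  exact this.2

theorem dual_tensorial (D : CovariantDerivative I V (TangentSpace I : M → Type _))
    {σ : Π x : M, CotangentSpace I x} {x : M} (hσ : FormDiffAt σ x) (v : TangentSpace I x) :
    TensorialAt I V (fun W : Π x : M, TangentSpace I x =>
      mvfderiv I (fun y => σ y (W y)) x v - σ x (D W x v)) x where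
  smul {f W} hf hW := by
    have h : (fun y => σ y ((f • W) y)) = fun y => f y * σ y (W y) := by
      ext y; simp
    rw [h, mvfderiv_fun_mul hf (mdiff_apply hσ hW), D.isCovariantDerivativeOn.leibniz hW hf]
    simp
    ring
  add {W W'} hW hW' := by
    have h : (fun y => σ y ((W + W') y)) = fun y => σ y (W y) + σ y (W' y) := by
      ext y; simp
    rw [h, mvfderiv_fun_add (mdiff_apply hσ hW) (mdiff_apply hσ hW'),
      D.isCovariantDerivativeOn.add hW hW']
    simp
    abel

/-- The vertical lift `T*_x M → T_γ (T*M)`, `x = π(γ)`: the differential at `γ` of the inclusion of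
the fibre `T*_x M` into `T*M`. -/
def vertLift (γ : CotangentBundle I M) :
    CotangentSpace I γ.proj →L[ℝ] TangentSpace (cotModel I) γ :=
  mfderiv 𝓘(ℝ, V →L[ℝ] ℝ) (cotModel I)
    (fun η : V →L[ℝ] ℝ => (⟨γ.proj, η⟩ : CotangentBundle I M)) γ.2

/-- The differential at `γ` of the projection `π : T*M → M`. -/
def dproj (γ : CotangentBundle I M) :
    TangentSpace (cotModel I) γ →L[ℝ] TangentSpace I γ.proj :=
  mfderiv (cotModel I) I (TotalSpace.proj : CotangentBundle I M → M) γ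

theorem exists_fibre_coord (x : M) : ∃ A : (V →L[ℝ] ℝ) →L[ℝ] (V →L[ℝ] ℝ),
    Function.Injective A ∧
    (fun η : V →L[ℝ] ℝ => (trivializationAt (V →L[ℝ] ℝ)
      (fun x : M => CotangentSpace I x) x (⟨x, η⟩ : CotangentBundle I M)).2) = A := by
  have hx := FiberBundle.mem_baseSet_trivializationAt' (F := V →L[ℝ] ℝ)
    (E := fun x : M => CotangentSpace I x) x
  refine ⟨((trivializationAt (V →L[ℝ] ℝ)
      (fun x : M => CotangentSpace I x) x).continuousLinearEquivAt ℝ x hx).toContinuousLinearMap,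
      ?_, ?_⟩
  · exact ((trivializationAt (V →L[ℝ] ℝ)
      (fun x : M => CotangentSpace I x) x).continuousLinearEquivAt ℝ x hx).injective
  · rfl

theorem mdiff_fibre (x : M) (η : V →L[ℝ] ℝ) :
    MDifferentiableAt 𝓘(ℝ, V →L[ℝ] ℝ) (cotModel I)
      (fun η : V →L[ℝ] ℝ => (⟨x, η⟩ : CotangentBundle I M)) η := by
  rw [mdifferentiableAt_totalSpace]
  refine ⟨mdifferentiableAt_const, ?_⟩
  obtain ⟨A, -, hA⟩ := exists_fibre_coord (I := I) x
  exact (congrArg (fun f => MDifferentiableAt 𝓘(ℝ, V →L[ℝ] ℝ) 𝓘(ℝ, V →L[ℝ] ℝ) f η) hA).mpr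
    A.mdifferentiableAt

theorem mdiff_proj (γ : CotangentBundle I M) :
    MDifferentiableAt (cotModel I) I (TotalSpace.proj : CotangentBundle I M → M) γ :=
  (Bundle.contMDiff_proj (n := 1) (IB := I)
    (fun x : M => CotangentSpace I x)).mdifferentiableAt one_ne_zero

theorem mdiff_coord (x : M) (η : V →L[ℝ] ℝ) :
    MDifferentiableAt (cotModel I) 𝓘(ℝ, V →L[ℝ] ℝ) (fun p : CotangentBundle I M =>
      (trivializationAt (V →L[ℝ] ℝ) (fun x : M => CotangentSpace I x) x p).2) ⟨x, η⟩ :=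
  ((mdifferentiableAt_totalSpace I (IM := cotModel I)
    (f := (id : CotangentBundle I M → CotangentBundle I M)) (x₀ := ⟨x, η⟩)).1
    mdifferentiableAt_id).2

theorem mfderiv_proj_fibre (x : M) (η : V →L[ℝ] ℝ) (ξ : V →L[ℝ] ℝ) :
    mfderiv (cotModel I) I (TotalSpace.proj : CotangentBundle I M → M) ⟨x, η⟩
      (mfderiv 𝓘(ℝ, V →L[ℝ] ℝ) (cotModel I)
        (fun η : V →L[ℝ] ℝ => (⟨x, η⟩ : CotangentBundle I M)) η ξ) = 0 := by
  have h := mfderiv_comp (I := 𝓘(ℝ, V →L[ℝ] ℝ)) (I' := cotModel I) (I'' := I) η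
    (g := (TotalSpace.proj : CotangentBundle I M → M))
    (f := (fun η : V →L[ℝ] ℝ => (⟨x, η⟩ : CotangentBundle I M)))
    (mdiff_proj _) (mdiff_fibre _ _)
  have h2 : (TotalSpace.proj : CotangentBundle I M → M) ∘
      (fun η : V →L[ℝ] ℝ => (⟨x, η⟩ : CotangentBundle I M)) = fun _ => x := rfl
  rw [h2, mfderiv_const] at h
  exact (DFunLike.congr_fun h ξ).symm

theorem dproj_vertLift (γ : CotangentBundle I M) (ξ : CotangentSpace I γ.proj) :
    dproj γ (vertLift γ ξ) = 0 := by
  obtain ⟨x, η⟩ := γ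
  exact mfderiv_proj_fibre x (show V →L[ℝ] ℝ from η) (show V →L[ℝ] ℝ from ξ)

theorem mfderiv_fibre_injective (x : M) (η : V →L[ℝ] ℝ) : Function.Injective
    (mfderiv 𝓘(ℝ, V →L[ℝ] ℝ) (cotModel I)
        (fun η : V →L[ℝ] ℝ => (⟨x, η⟩ : CotangentBundle I M)) η) := by
  have h := mfderiv_comp (I := 𝓘(ℝ, V →L[ℝ] ℝ)) (I' := cotModel I)
    (I'' := 𝓘(ℝ, V →L[ℝ] ℝ)) η
    (g := fun p : CotangentBundle I M =>
      (trivializationAt (V →L[ℝ] ℝ) (fun x : M => CotangentSpace I x) x p).2)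
    (f := (fun η : V →L[ℝ] ℝ => (⟨x, η⟩ : CotangentBundle I M)))
    (mdiff_coord _ _) (mdiff_fibre _ _)
  obtain ⟨A, hA, hA'⟩ := exists_fibre_coord (I := I) x
  have h2 : ((fun p : CotangentBundle I M =>
      (trivializationAt (V →L[ℝ] ℝ) (fun x : M => CotangentSpace I x) x p).2) ∘
      (fun η : V →L[ℝ] ℝ => (⟨x, η⟩ : CotangentBundle I M))) = A := hA'
  rw [h2, ContinuousLinearMap.mfderiv_eq] at h
  intro a b hab
  apply hA
  have ha := DFunLike.congr_fun h a
  have hb := DFunLike.congr_fun h b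
  exact ha.trans ((congrArg (mfderiv (cotModel I) 𝓘(ℝ, V →L[ℝ] ℝ) (fun p : CotangentBundle I M =>
      (trivializationAt (V →L[ℝ] ℝ) (fun x : M => CotangentSpace I x) x p).2) ⟨x, η⟩)
      hab).trans hb.symm)

theorem vertLift_injective (γ : CotangentBundle I M) : Function.Injective (vertLift γ) := by
  obtain ⟨x, η⟩ := γ
  exact mfderiv_fibre_injective x (show V →L[ℝ] ℝ from η)

variable [FiniteDimensional ℝ V]

open Classical in
/-- The connection on the cotangent bundle induced by a linear connection `D`:
`(D_v σ)(W) = v(σ(W)) - σ(D_v W)` for 1-forms `σ` and vector fields `W` (differentiable at the point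
considered; `D σ` is set to zero where `σ` is not differentiable). -/
def dualConnection (D : CovariantDerivative I V (TangentSpace I : M → Type _)) :
    CovariantDerivative I (V →L[ℝ] ℝ) (fun x : M => CotangentSpace I x) where
  toFun σ x :=
    if hσ : FormDiffAt σ x then
      haveI : FiniteDimensional ℝ (TangentSpace I x) := inferInstanceAs (FiniteDimensional ℝ V)
      haveI : T2Space (TangentSpace I x) := inferInstanceAs (T2Space V)
      LinearMap.toContinuousLinearMap
        { toFun := fun v => TensorialAt.mkHom (fun W : Π x : M, TangentSpace I x =>
            mvfderiv I (fun y => σ y (W y)) x v - σ x (D W x v)) x (dual_tensorial D hσ v)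
          map_add' := by
            intro v w
            ext u
            simp only [TensorialAt.mkHom_apply_eq_extend, map_add, add_apply]
            ring
          map_smul' := by
            intro c v
            ext u
            simp only [TensorialAt.mkHom_apply_eq_extend, map_smul, smul_apply,
              smul_eq_mul, RingHom.id_apply]
            ring }
    else 0
  isCovariantDerivativeOnUniv :=
    { add := by
        intro σ τ x hσ hτ _
        have h : FormDiffAt (σ + τ) x := mdifferentiableAt_add_section hσ hτ
        ext v u
        rw [dif_pos hσ, dif_pos hτ, dif_pos h]
        have hu := mdifferentiableAt_extend I V u
        have e : (fun y => (σ + τ) y (extend V u y))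
          = fun y => σ y (extend V u y) + τ y (extend V u y) := by ext y; simp
        simp only [LinearMap.coe_toContinuousLinearMap', LinearMap.coe_mk, AddHom.coe_mk,
          TensorialAt.mkHom_apply_eq_extend, add_apply]
        rw [e, mvfderiv_fun_add (mdiff_apply hσ hu) (mdiff_apply hτ hu)]
        simp
        ring
      leibniz := by
        intro σ f x hσ hf _
        have h : FormDiffAt (f • σ) x := hf.smul_section hσ
        ext v u
        rw [dif_pos hσ, dif_pos h]
        have hu := mdifferentiableAt_extend I V u
        have e : (fun y => (f • σ) y (extend V u y))
          = fun y => f y * σ y (extend V u y) := by ext y; simp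
        simp only [LinearMap.coe_toContinuousLinearMap', LinearMap.coe_mk, AddHom.coe_mk,
          TensorialAt.mkHom_apply_eq_extend, add_apply]
        rw [e, mvfderiv_fun_mul hf (mdiff_apply hσ hu)]
        simp [TensorialAt.mkHom_apply_eq_extend]
        ring }

theorem dualConnection_apply (D : CovariantDerivative I V (TangentSpace I : M → Type _))
    {σ : Π x : M, CotangentSpace I x} {W : Π x : M, TangentSpace I x} {x : M}
    (hσ : FormDiffAt σ x) (hW : MDiffAt (T% W) x) (v : TangentSpace I x) :
    dualConnection D σ x v (W x) = mvfderiv I (fun y => σ y (W y)) x v - σ x (D W x v) := by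
  simp only [dualConnection]
  rw [dif_pos hσ]
  exact TensorialAt.mkHom_apply (dual_tensorial D hσ v) hW

/-- The `D`-horizontal lift `T_x M → T_γ (T*M)`, `x = π(γ)`: the vector `v` is lifted to
`dσ(v) - (D_v σ)`, where `σ` is a 1-form with `σ(x) = γ` that is smooth near `x` (the result does
not depend on the choice of `σ`) and `D_v σ ∈ T*_x M` is regarded as a vertical vector. -/
def horLift (D : CovariantDerivative I V (TangentSpace I : M → Type _))
    (γ : CotangentBundle I M) : TangentSpace I γ.proj →L[ℝ] TangentSpace (cotModel I) γ :=
  (show TangentSpace I γ.proj →L[ℝ] TangentSpace (cotModel I) γ from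
    mfderiv I (cotModel I) (formSection (extend (V →L[ℝ] ℝ) γ.2)) γ.proj)
    - (vertLift γ) ∘L (dualConnection D (extend (V →L[ℝ] ℝ) γ.2) γ.proj)

theorem dproj_horLift (D : CovariantDerivative I V (TangentSpace I : M → Type _))
    (γ : CotangentBundle I M) (v : TangentSpace I γ.proj) :
    dproj γ (horLift D γ v) = v := by
  have hs : FormDiffAt (extend (V →L[ℝ] ℝ) γ.2) γ.proj := mdifferentiableAt_extend I _ γ.2
  have h := mfderiv_comp (I := I) (I' := cotModel I) (I'' := I) γ.proj
    (g := (TotalSpace.proj : CotangentBundle I M → M))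
    (f := formSection (extend (V →L[ℝ] ℝ) γ.2))
    (mdiff_proj _) hs
  have h2 : (TotalSpace.proj : CotangentBundle I M → M) ∘
      (formSection (extend (V →L[ℝ] ℝ) γ.2)) = id := rfl
  rw [h2, mfderiv_id] at h
  have h3 : formSection (extend (V →L[ℝ] ℝ) γ.2) γ.proj = γ := by
    simp [formSection]
  have h4 := (DFunLike.congr_fun h v).symm
  rw [ContinuousLinearMap.comp_apply] at h4
  have h5 := dproj_vertLift γ (dualConnection D (extend (V →L[ℝ] ℝ) γ.2) γ.proj v)
  have h6 : dproj γ (horLift D γ v) = dproj γ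
      (show TangentSpace (cotModel I) γ from
        mfderiv I (cotModel I) (formSection (extend (V →L[ℝ] ℝ) γ.2)) γ.proj v) -
      dproj γ (vertLift γ (dualConnection D (extend (V →L[ℝ] ℝ) γ.2) γ.proj v)) :=
    ContinuousLinearMap.map_sub (dproj γ) _ _
  rw [h6, h5, sub_zero]
  refine Eq.trans ?_ h4
  unfold dproj
  congr 1
  rw [h3]

/-- The map `T_x M ⊕ T*_x M → T_γ (T*M)`, `x = π(γ)`, sending `X + ξ` to the sum of the horizontal
lift of `X` and the vertical lift of `ξ`. -/
def splittingMap (D : CovariantDerivative I V (TangentSpace I : M → Type _))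
    (γ : CotangentBundle I M) : GenTangentSpace I γ.proj →ₗ[ℝ] TangentSpace (cotModel I) γ :=
  (horLift D γ).toLinearMap.coprod (vertLift γ).toLinearMap

theorem splittingMap_bijective (D : CovariantDerivative I V (TangentSpace I : M → Type _))
    (γ : CotangentBundle I M) : Function.Bijective (splittingMap D γ) := by
  have hinj : Function.Injective (splittingMap D γ) := by
    rw [injective_iff_map_eq_zero]
    rintro ⟨v, ξ⟩ h
    have h1 : horLift D γ v + vertLift γ ξ = 0 := h
    have h2 : dproj γ (horLift D γ v) + dproj γ (vertLift γ ξ) = 0 :=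
      ((dproj γ).map_add _ _).symm.trans ((congrArg (dproj γ) h1).trans (dproj γ).map_zero)
    rw [dproj_horLift, dproj_vertLift, add_zero] at h2
    subst h2
    rw [ContinuousLinearMap.map_zero, zero_add] at h1
    have h3 : ξ = 0 := vertLift_injective γ (h1.trans (vertLift γ).map_zero.symm)
    rw [h3]
    rfl
  refine ⟨hinj, ?_⟩
  have h1 : FiniteDimensional ℝ (GenTangentSpace I γ.proj) :=
    inferInstanceAs (FiniteDimensional ℝ (V × (V →L[ℝ] ℝ)))
  have h2 : FiniteDimensional ℝ (TangentSpace (cotModel I) γ) :=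
    inferInstanceAs (FiniteDimensional ℝ (V × (V →L[ℝ] ℝ)))
  exact (LinearMap.injective_iff_surjective_of_finrank_eq_finrank rfl).1 hinj

/-- The identification `T_γ (T*M) = H^D_γ ⊕ T^vert_γ (T*M) = T_x M ⊕ T*_x M`, `x = π(γ)`. -/
def splitting (D : CovariantDerivative I V (TangentSpace I : M → Type _))
    (γ : CotangentBundle I M) : GenTangentSpace I γ.proj ≃ₗ[ℝ] TangentSpace (cotModel I) γ :=
  LinearEquiv.ofBijective (splittingMap D γ) (splittingMap_bijective D γ)

/-- The almost complex structure `J^{𝒥, D} = π*𝒥` on the cotangent manifold. -/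
def inducedACS (𝒥 : Π x : M, GenTangentSpace I x →L[ℝ] GenTangentSpace I x)
    (D : CovariantDerivative I V (TangentSpace I : M → Type _)) (γ : CotangentBundle I M) :
    TangentSpace (cotModel I) γ →ₗ[ℝ] TangentSpace (cotModel I) γ :=
  (splitting D γ).conj (𝒥 γ.proj).toLinearMap

end Cotangent

end CotangentGC

end

/-! Complex vectors on `T*M` are tested on two kinds of functions: pullbacks `f ∘ π` and momenta
`p_W(γ) = γ(W)` of complex vector fields `W`. The horizontal/vertical splitting enters through
`cderiv_momentum`: `z(p_W) = γ(D_{πz} W) + ⟨vert z, W⟩`. Writing `F = τ(E)` and `A` for an extension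
of `α`, a vector `z` is in the `i`-eigenspace of the induced structure iff `πz ∈ E` and `z(p_W) =
γ(D_{πz} W) + A(πz, W)` for all `W ∈ Γ(F)`. Brackets are computed as commutators of derivations
(`cderiv_lieBracket`), so involutivity becomes an identity between functions.

Necessity: lift sections `X + ξ`, `Y + η` of the holomorphic bundle to `T*M`. Their bracket projects
to `[X, Y]`, which gives (i). Applied to `p_W`, the membership condition says that `γ(R_{X,Y} W)`
equals an expression depending only on the base point. The left side is linear in `γ`, so both sides
vanish: this is the curvature condition together with (iii). The covector `ξ` is free outside `F`;
varying it by functionals that vanish on `F` forces `D_X W ∈ F`. See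
`structure_equations_of_involutive` and `cov_mem_of_involutive`.

Sufficiency (`inLift_lieBracket`): a section of the eigenbundle projects to `Σ c_j e_j`, for a local
frame `e_j` of `E` and smooth functions `c_j` on `T*M`. It acts on `p_W` as `Σ c_j (p_{D_{e_j} W} +
A(e_j, W))`, and since `D_{e_j} W` is again a section of `F`, a second derivation has the same form.
In the commutator, curvature and torsion equations identify the terms quadratic in the coefficients
with those of `[e_i, e_j]`.

Both directions are proved for arbitrary subbundles `E` and `F`; `τ` returns only at the end. -/

noncomputable section

namespace CotangentGC

/-! ### Real vector fields: brackets as commutators of derivations -/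

section Real

open scoped Topology

variable {V : Type*} [NormedAddCommGroup V] [NormedSpace ℝ V] [CompleteSpace V]
  {H : Type*} [TopologicalSpace H] {I : ModelWithCorners ℝ V H} [I.Boundaryless]
  {M : Type*} [TopologicalSpace M] [ChartedSpace H M] [IsManifold I ∞ M]
  {F : Type*} [NormedAddCommGroup F] [NormedSpace ℝ F]

/-- The coordinate expression of a vector field in the chart at `x`. -/
def chartField (I : ModelWithCorners ℝ V H) (X : Π y : M, TangentSpace I y) (x : M) : V → V :=
  VectorField.mpullbackWithin 𝓘(ℝ, V) I (extChartAt I x).symm X (Set.range I)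

theorem contDiffAt_chartField {X : Π y : M, TangentSpace I y} {x : M}
    (hX : ContMDiffAt I I.tangent ∞ (fun y => (⟨y, X y⟩ : TangentBundle I M)) x) :
    ContDiffAt ℝ ∞ (chartField I X x) (extChartAt I x x) := by
  have : IsManifold I 1 M := IsManifold.of_le (n := ∞) (by simp)
  have h := VectorField.contMDiffWithinAt_mpullbackWithin_extChartAt_symm (m := ∞) (n := ∞)
    (contMDiffWithinAt_univ.2 hX) uniqueMDiffOn_univ (Set.mem_univ x) (by simp)
  have ht : (extChartAt I x).target ∩ (extChartAt I x).symm ⁻¹' Set.univ ∈ 𝓝 (extChartAt I x x) := by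
    simpa using extChartAt_target_mem_nhds (I := I) x
  exact contMDiffAt_vectorSpace_iff_contDiffAt.1 (h.contMDiffAt ht)

omit [CompleteSpace V] [I.Boundaryless] in
theorem eventually_mfderiv_extChartAt_apply (X : Π y : M, TangentSpace I y) (x : M) :
    ∀ᶠ y in 𝓝 x, mvfderiv I (extChartAt I x) y (X y) = chartField I X x (extChartAt I x y) := by
  have : IsManifold I 1 M := IsManifold.of_le (n := ∞) (by simp)
  have h := VectorField.eventuallyEq_mpullback_mpullbackWithin_extChartAt (s := Set.univ) (x := x) X
  rw [nhdsWithin_univ] at h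
  filter_upwards [h, extChartAt_source_mem_nhds (I := I) x] with y hy hs
  have := (isInvertible_mfderiv_extChartAt hs).inverse_apply_eq.1 hy.symm
  exact this.symm

-- Chain rule for `f = (f ∘ φ⁻¹) ∘ φ` with `φ` the chart at `x`. It is needed at all nearby points,
-- because the resulting formula is differentiated once more.
omit [CompleteSpace V] in
theorem eventually_mvfderiv_eq {f : M → F} {x : M} (hf : ContMDiffAt I 𝓘(ℝ, F) 1 f x) :
    ∀ᶠ y in 𝓝 x, ∀ v : TangentSpace I y, mvfderiv I f y v =
      fderiv ℝ (f ∘ (extChartAt I x).symm) (extChartAt I x y) (mvfderiv I (extChartAt I x) y v) := by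
  have : IsManifold I 1 M := IsManifold.of_le (n := ∞) (by simp)
  have h1 := (contMDiffAt_iff_contMDiffAt_nhds (by simp)).1 hf
  filter_upwards [h1, extChartAt_source_mem_nhds (I := I) x] with y hy hs v
  have hsym : ContMDiffAt 𝓘(ℝ, V) I 1 (extChartAt I x).symm (extChartAt I x y) := by
    have := contMDiffOn_extChartAt_symm (I := I) (n := 1) x
    exact this.contMDiffAt (extChartAt_target_mem_nhds' ((extChartAt I x).map_source hs))
  have hf' : MDifferentiableAt 𝓘(ℝ, V) 𝓘(ℝ, F) (f ∘ (extChartAt I x).symm) (extChartAt I x y) := by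
    refine MDifferentiableAt.comp (I' := I) _ ?_ (hsym.mdifferentiableAt (by simp))
    rw [(extChartAt I x).left_inv hs]
    exact hy.mdifferentiableAt (by simp)
  have hφ : MDifferentiableAt I 𝓘(ℝ, V) (extChartAt I x) y :=
    (contMDiffAt_extChartAt' (n := 1) (by simpa using hs)).mdifferentiableAt (by simp)
  have h2 := mfderiv_comp_apply y hf' hφ v
  have h3 : (f ∘ (extChartAt I x).symm) ∘ (extChartAt I x) =ᶠ[𝓝 y] f := by
    filter_upwards [(isOpen_extChartAt_source (I := I) x).mem_nhds hs] with z hz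
    exact congrArg f ((extChartAt I x).left_inv hz)
  rw [h3.mfderiv_eq] at h2
  rw [mfderiv_eq_fderiv] at h2
  exact h2

omit [CompleteSpace V] [IsManifold I ∞ M] in
theorem contDiffAt_chart_expr {f : M → F} {x : M} (hf : ContMDiffAt I 𝓘(ℝ, F) ∞ f x) :
    ContDiffAt ℝ ∞ (f ∘ (extChartAt I x).symm) (extChartAt I x x) := by
  have h := (contMDiffAt_iff.1 hf).2
  rw [I.range_eq_univ] at h
  exact h.contDiffAt Filter.univ_mem

omit [CompleteSpace V] in
theorem eventually_mvfderiv_apply {X : Π y : M, TangentSpace I y} {f : M → F} {x : M}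
    (hf : ContMDiffAt I 𝓘(ℝ, F) ∞ f x) :
    ∀ᶠ y in 𝓝 x, mvfderiv I f y (X y) =
      fderiv ℝ (f ∘ (extChartAt I x).symm) (extChartAt I x y)
        (chartField I X x (extChartAt I x y)) := by
  filter_upwards [eventually_mvfderiv_eq (hf.of_le (by simp)),
    eventually_mfderiv_extChartAt_apply X x] with y h1 h2
  rw [h1, h2]

theorem contMDiffAt_mvfderiv_apply {X : Π y : M, TangentSpace I y} {f : M → F} {x : M}
    (hX : ContMDiffAt I I.tangent ∞ (fun y => (⟨y, X y⟩ : TangentBundle I M)) x)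
    (hf : ContMDiffAt I 𝓘(ℝ, F) ∞ f x) :
    ContMDiffAt I 𝓘(ℝ, F) ∞ (fun y => mvfderiv I f y (X y)) x := by
  have h : ContDiffAt ℝ ∞ (fun u => fderiv ℝ (f ∘ (extChartAt I x).symm) u (chartField I X x u))
      (extChartAt I x x) :=
    ((contDiffAt_chart_expr hf).fderiv_right (m := ∞) (by simp)).clm_apply
      (contDiffAt_chartField hX)
  have h2 : ContMDiffAt I 𝓘(ℝ, F) ∞ ((fun u => fderiv ℝ (f ∘ (extChartAt I x).symm) u
      (chartField I X x u)) ∘ extChartAt I x) x :=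
    h.contMDiffAt.comp x (contMDiffAt_extChartAt (I := I) (x := x))
  exact h2.congr_of_eventuallyEq (eventually_mvfderiv_apply hf)

/-- In the chart, `X(Yf)` and `Y(Xf)` contain the same second derivative of `f`, by symmetry; what
survives in the difference is the first derivative of `f` along the coordinate bracket. -/
theorem mvfderiv_mlieBracket {X Y : Π y : M, TangentSpace I y} {f : M → F} {x : M}
    (hX : ContMDiffAt I I.tangent ∞ (fun y => (⟨y, X y⟩ : TangentBundle I M)) x)
    (hY : ContMDiffAt I I.tangent ∞ (fun y => (⟨y, Y y⟩ : TangentBundle I M)) x)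
    (hf : ContMDiffAt I 𝓘(ℝ, F) ∞ f x) :
    mvfderiv I f x (VectorField.mlieBracket I X Y x) =
      mvfderiv I (fun y => mvfderiv I f y (Y y)) x (X x)
        - mvfderiv I (fun y => mvfderiv I f y (X y)) x (Y x) := by
  have : IsManifold I 1 M := IsManifold.of_le (n := ∞) (by simp)
  set p := extChartAt I x x with hp
  set g := f ∘ (extChartAt I x).symm with hg
  have hgs : ContDiffAt ℝ ∞ g p := contDiffAt_chart_expr hf
  have key : ∀ {A B : Π y : M, TangentSpace I y},
      ContMDiffAt I I.tangent ∞ (fun y => (⟨y, A y⟩ : TangentBundle I M)) x →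
      mvfderiv I (fun y => mvfderiv I f y (A y)) x (B x) =
        fderiv ℝ (fderiv ℝ g) p (chartField I B x p) (chartField I A x p)
          + fderiv ℝ g p (fderiv ℝ (chartField I A x) p (chartField I B x p)) := by
    intro A B hA
    have hd1 : DifferentiableAt ℝ (fderiv ℝ g) p :=
      (hgs.fderiv_right (m := ∞) (by simp)).differentiableAt (by simp)
    have hd2 : DifferentiableAt ℝ (chartField I A x) p :=
      (contDiffAt_chartField hA).differentiableAt (by simp)
    have e1 := eventually_mvfderiv_apply (X := A) hf
    have e2 := (eventually_mvfderiv_apply (X := B) (contMDiffAt_mvfderiv_apply hA hf)).self_of_nhds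
    rw [e2]
    have e3 : (fun y => mvfderiv I f y (A y)) ∘ (extChartAt I x).symm =ᶠ[𝓝 p]
        fun u => fderiv ℝ g u (chartField I A x u) := by
      have hc : Filter.Tendsto (extChartAt I x).symm (𝓝 p) (𝓝 x) := by
        have := (continuousAt_extChartAt_symm (I := I) x).tendsto
        rwa [extChartAt_to_inv] at this
      filter_upwards [hc.eventually e1, extChartAt_target_mem_nhds (I := I) x] with u hu ht
      simp only [Function.comp_apply]
      rw [hu, (extChartAt I x).right_inv ht]
    rw [e3.fderiv_eq, fderiv_clm_apply hd1 hd2]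
    rw [add_apply, ContinuousLinearMap.comp_apply, ContinuousLinearMap.flip_apply, add_comm]
  rw [key hY, key hX]
  have hsymm := (hgs.isSymmSndFDerivAt
    (by rw [minSmoothness_of_isRCLikeNormedField]; exact
      WithTop.coe_le_coe.2 (le_top : (2 : ℕ∞) ≤ ⊤))).eq (chartField I X x p) (chartField I Y x p)
  rw [hsymm]
  set w : V := VectorField.lieBracket ℝ (chartField I X x) (chartField I Y x) p with hw
  have hb : mvfderiv I f x (VectorField.mlieBracket I X Y x) = fderiv ℝ g p w := by
    have h1 := (eventually_mvfderiv_eq (hf.of_le (by simp))).self_of_nhds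
      (VectorField.mlieBracket I X Y x)
    rw [h1]
    congr 1
    -- By definition the bracket on the manifold is the coordinate bracket pulled back by the chart.
    have h2 : VectorField.mlieBracket I X Y x = (mfderiv I 𝓘(ℝ, V) (extChartAt I x) x).inverse w := by
      have hw' : w = VectorField.lieBracketWithin ℝ (chartField I X x) (chartField I Y x)
          ((extChartAt I x).symm ⁻¹' Set.univ ∩ Set.range I) p := by
        rw [I.range_eq_univ, Set.preimage_univ, Set.inter_univ, VectorField.lieBracketWithin_univ]
      rw [hw']
      rfl
    exact ((isInvertible_mfderiv_extChartAt (mem_extChartAt_source x)).inverse_apply_eq.1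
      h2.symm).symm
  rw [hb, hw, VectorField.lieBracket, map_sub]
  abel

end Real

/-! ### Real and imaginary parts in a complexification -/

section Complexification

variable {W : Type*} [AddCommGroup W] [Module ℝ W] {W' : Type*} [AddCommGroup W'] [Module ℝ W']

theorem ext_cre_cim {z w : ℂ ⊗[ℝ] W} (hr : cre z = cre w) (hi : cim z = cim w) : z = w := by
  rw [← cmk_cre_cim z, ← cmk_cre_cim w, hr, hi]

theorem cre_smul (c : ℂ) (z : ℂ ⊗[ℝ] W) : cre (c • z) = c.re • cre z - c.im • cim z := by
  induction z with
  | zero => simp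
  | tmul a w => simp [TensorProduct.smul_tmul', sub_smul, mul_smul]
  | add x y hx hy => rw [smul_add, map_add, hx, hy, map_add, map_add]; module

theorem cim_smul (c : ℂ) (z : ℂ ⊗[ℝ] W) : cim (c • z) = c.re • cim z + c.im • cre z := by
  induction z with
  | zero => simp
  | tmul a w => simp [TensorProduct.smul_tmul', add_smul, mul_smul]
  | add x y hx hy => rw [smul_add, map_add, hx, hy, map_add, map_add]; module

@[simp] theorem cre_cconj (z : ℂ ⊗[ℝ] W) : cre (cconj z) = cre z := by
  induction z with
  | zero => simp
  | tmul a w => simp [cconj]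
  | add x y hx hy => rw [map_add, map_add, hx, hy, map_add]

@[simp] theorem cim_cconj (z : ℂ ⊗[ℝ] W) : cim (cconj z) = -cim z := by
  induction z with
  | zero => simp
  | tmul a w => simp [cconj]
  | add x y hx hy => rw [map_add, map_add, hx, hy, map_add, neg_add]

@[simp] theorem cconj_cconj (z : ℂ ⊗[ℝ] W) : cconj (cconj z) = z :=
  ext_cre_cim (by simp) (by simp)

@[simp] theorem cre_baseChange (A : W →ₗ[ℝ] W') (z : ℂ ⊗[ℝ] W) :
    cre (A.baseChange ℂ z) = A (cre z) := by
  induction z with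
  | zero => simp
  | tmul a w => simp
  | add x y hx hy => simp [hx, hy]

@[simp] theorem cim_baseChange (A : W →ₗ[ℝ] W') (z : ℂ ⊗[ℝ] W) :
    cim (A.baseChange ℂ z) = A (cim z) := by
  induction z with
  | zero => simp
  | tmul a w => simp
  | add x y hx hy => simp [hx, hy]

/-- The complex linear extension of a real linear map into `ℂ`. -/
def complexify (A : W →ₗ[ℝ] ℂ) : ℂ ⊗[ℝ] W →ₗ[ℂ] ℂ := LinearMap.liftBaseChange ℂ A

theorem complexify_apply (A : W →ₗ[ℝ] ℂ) (z : ℂ ⊗[ℝ] W) :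
    complexify A z = A (cre z) + Complex.I * A (cim z) := by
  induction z with
  | zero => simp
  | tmul a w =>
    simp only [complexify, LinearMap.liftBaseChange_tmul, smul_eq_mul, cre_tmul, map_smul,
      Complex.real_smul, cim_tmul]
    conv_lhs => rw [← Complex.re_add_im a]
    ring
  | add x y hx hy => rw [map_add, hx, hy, map_add, map_add, map_add, map_add]; ring

/-- The real linear map with a given complex linear extension. -/
def restrictReal (B : ℂ ⊗[ℝ] W →ₗ[ℂ] ℂ) : W →ₗ[ℝ] ℂ :=
  B.restrictScalars ℝ ∘ₗ TensorProduct.mk ℝ ℂ W 1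

@[simp] theorem complexify_restrictReal (B : ℂ ⊗[ℝ] W →ₗ[ℂ] ℂ) :
    complexify (restrictReal B) = B := by
  ext w
  simp [complexify, restrictReal]

end Complexification

/-! ### Complex differentials, smooth complex fields and their brackets -/

section Calculus

open scoped Topology

variable {V : Type*} [NormedAddCommGroup V] [NormedSpace ℝ V]
  {H : Type*} [TopologicalSpace H] (I : ModelWithCorners ℝ V H)
  {M : Type*} [TopologicalSpace M] [ChartedSpace H M]

/-- The complex differential of a complex valued function. -/
def cderiv (f : M → ℂ) (x : M) : ComplexTangentSpace I x →ₗ[ℂ] ℂ :=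
  complexify (mvfderiv I f x).toLinearMap

variable {I}

theorem cderiv_apply (f : M → ℂ) (x : M) (z : ComplexTangentSpace I x) :
    cderiv I f x z = mvfderiv I f x (cre z) + Complex.I * mvfderiv I f x (cim z) :=
  complexify_apply _ _

theorem fieldDeriv_eq (Z : Π x : M, ComplexTangentSpace I x) (f : M → ℂ) (x : M) :
    fieldDeriv Z f x = cderiv I f x (Z x) :=
  (cderiv_apply f x (Z x)).symm

theorem cderiv_congr {f g : M → ℂ} {x : M} (h : f =ᶠ[𝓝 x] g) : cderiv I f x = cderiv I g x := by
  have : mvfderiv I f x = mvfderiv I g x := by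
    ext v
    unfold mvfderiv
    rw [h.mfderiv_eq]
    rfl
  rw [cderiv, this, cderiv]

theorem cderiv_add {f g : M → ℂ} {x : M} (hf : MDifferentiableAt I 𝓘(ℝ, ℂ) f x)
    (hg : MDifferentiableAt I 𝓘(ℝ, ℂ) g x) :
    cderiv I (fun y => f y + g y) x = cderiv I f x + cderiv I g x := by
  refine LinearMap.ext fun z => ?_
  rw [LinearMap.add_apply, cderiv_apply, cderiv_apply, cderiv_apply, mvfderiv_fun_add hf hg]
  simp only [add_apply]
  ring

theorem mvfderiv_cmul {f g : M → ℂ} {x : M} (hf : MDifferentiableAt I 𝓘(ℝ, ℂ) f x)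
    (hg : MDifferentiableAt I 𝓘(ℝ, ℂ) g x) (v : TangentSpace I x) :
    mvfderiv I (fun y => f y * g y) x v = f x * mvfderiv I g x v + g x * mvfderiv I f x v :=
  DFunLike.congr_fun (hf.hasMFDerivAt.mul hg.hasMFDerivAt).mfderiv v

theorem cderiv_mul {f g : M → ℂ} {x : M} (hf : MDifferentiableAt I 𝓘(ℝ, ℂ) f x)
    (hg : MDifferentiableAt I 𝓘(ℝ, ℂ) g x) :
    cderiv I (fun y => f y * g y) x = f x • cderiv I g x + g x • cderiv I f x := by
  refine LinearMap.ext fun z => ?_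
  simp only [LinearMap.add_apply, LinearMap.smul_apply, smul_eq_mul, cderiv_apply,
    mvfderiv_cmul hf hg]
  ring

theorem cderiv_const (c : ℂ) (x : M) : cderiv I (fun _ : M => c) x = 0 := by
  refine LinearMap.ext fun z => ?_
  rw [cderiv_apply, mvfderiv_const]
  simp

theorem mdifferentiableAt_sum {ι : Type*} (s : Finset ι) {f : ι → M → ℂ} {x : M}
    (hf : ∀ i ∈ s, MDifferentiableAt I 𝓘(ℝ, ℂ) (f i) x) :
    MDifferentiableAt I 𝓘(ℝ, ℂ) (fun y => ∑ i ∈ s, f i y) x := by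
  classical
  induction s using Finset.induction_on with
  | empty => simpa using mdifferentiableAt_const
  | insert a s ha ih =>
    simp only [Finset.sum_insert ha]
    exact (hf a (Finset.mem_insert_self a s)).add
      (ih fun i hi => hf i (Finset.mem_insert_of_mem hi))

theorem cderiv_sum {ι : Type*} (s : Finset ι) {f : ι → M → ℂ} {x : M}
    (hf : ∀ i ∈ s, MDifferentiableAt I 𝓘(ℝ, ℂ) (f i) x) :
    cderiv I (fun y => ∑ i ∈ s, f i y) x = ∑ i ∈ s, cderiv I (f i) x := by
  classical
  induction s using Finset.induction_on with
  | empty => simpa using cderiv_const (I := I) 0 x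
  | insert a s ha ih =>
    have hs := fun i hi => hf i (Finset.mem_insert_of_mem hi)
    simp only [Finset.sum_insert ha]
    rw [cderiv_add (hf a (Finset.mem_insert_self a s)) (mdifferentiableAt_sum s hs), ih hs]

theorem _root_.ContMDiffAt.cmul {f g : M → ℂ} {x : M} (hf : ContMDiffAt I 𝓘(ℝ, ℂ) ∞ f x)
    (hg : ContMDiffAt I 𝓘(ℝ, ℂ) ∞ g x) : ContMDiffAt I 𝓘(ℝ, ℂ) ∞ (fun y => f y * g y) x :=
  ((contDiff_fst.mul contDiff_snd : ContDiff ℝ ∞ fun p : ℂ × ℂ => p.1 * p.2).contMDiff.contMDiffAt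
    (x := (f x, g x))).comp x (hf.prodMk_space hg)

theorem contMDiffAt_sum {ι : Type*} (s : Finset ι) {f : ι → M → ℂ} {x : M}
    (hf : ∀ i ∈ s, ContMDiffAt I 𝓘(ℝ, ℂ) ∞ (f i) x) :
    ContMDiffAt I 𝓘(ℝ, ℂ) ∞ (fun y => ∑ i ∈ s, f i y) x := by
  classical
  induction s using Finset.induction_on with
  | empty => simpa using contMDiffAt_const
  | insert a s ha ih =>
    simp only [Finset.sum_insert ha]
    exact (hf a (Finset.mem_insert_self a s)).add
      (ih fun i hi => hf i (Finset.mem_insert_of_mem hi))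

/-- Smoothness of a complex vector field at a point. -/
def CSmoothAt [IsManifold I 1 M] (Z : Π x : M, ComplexTangentSpace I x) (x : M) : Prop :=
  ContMDiffAt I I.tangent ∞ (fun x => (⟨x, cre (Z x)⟩ : TangentBundle I M)) x ∧
  ContMDiffAt I I.tangent ∞ (fun x => (⟨x, cim (Z x)⟩ : TangentBundle I M)) x

theorem SmoothOn.csmoothAt [IsManifold I 1 M] {Z : Π x : M, ComplexTangentSpace I x} {U : Set M}
    (h : SmoothOn I Z U) {x : M} (hU : U ∈ 𝓝 x) : CSmoothAt Z x :=
  ⟨h.1.contMDiffAt hU, h.2.contMDiffAt hU⟩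

theorem smoothOn_univ_iff [IsManifold I 1 M] {Z : Π x : M, ComplexTangentSpace I x} :
    SmoothOn I Z Set.univ ↔ ∀ x, CSmoothAt Z x :=
  ⟨fun h _ => h.csmoothAt Filter.univ_mem,
    fun h => ⟨fun x _ => (h x).1.contMDiffWithinAt, fun x _ => (h x).2.contMDiffWithinAt⟩⟩

section Algebra

variable [IsManifold I ∞ M] {Z Z' : Π x : M, ComplexTangentSpace I x} {x : M}

theorem CSmoothAt.congr (hZ : CSmoothAt Z x) (h : ∀ᶠ y in 𝓝 x, Z' y = Z y) : CSmoothAt Z' x := by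
  refine ⟨hZ.1.congr_of_eventuallyEq ?_, hZ.2.congr_of_eventuallyEq ?_⟩ <;>
  · filter_upwards [h] with y hy
    rw [hy]

theorem CSmoothAt.add (hZ : CSmoothAt Z x) (hZ' : CSmoothAt Z' x) :
    CSmoothAt (fun y => Z y + Z' y) x := by
  refine ⟨?_, ?_⟩
  · simp only [map_add]
    exact hZ.1.add_section hZ'.1
  · simp only [map_add]
    exact hZ.2.add_section hZ'.2

theorem CSmoothAt.smul {f : M → ℂ} (hf : ContMDiffAt I 𝓘(ℝ, ℂ) ∞ f x) (hZ : CSmoothAt Z x) :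
    CSmoothAt (fun y => f y • Z y) x := by
  have hre : ContMDiffAt I 𝓘(ℝ, ℝ) ∞ (fun y => (f y).re) x :=
    Complex.reCLM.contDiff.contMDiff.contMDiffAt.comp x hf
  have him : ContMDiffAt I 𝓘(ℝ, ℝ) ∞ (fun y => (f y).im) x :=
    Complex.imCLM.contDiff.contMDiff.contMDiffAt.comp x hf
  refine ⟨?_, ?_⟩
  · simp only [cre_smul]
    exact (hre.smul_section hZ.1).sub_section (him.smul_section hZ.2)
  · simp only [cim_smul]
    exact (hre.smul_section hZ.2).add_section (him.smul_section hZ.1)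

theorem csmoothAt_zero : CSmoothAt (fun y => (0 : ComplexTangentSpace I y)) x := by
  refine ⟨?_, ?_⟩ <;>
  · simp only [map_zero]
    exact contMDiffAt_zeroSection ..

theorem CSmoothAt.sum {ι : Type*} (s : Finset ι) {Z : ι → Π x : M, ComplexTangentSpace I x}
    (hZ : ∀ i ∈ s, CSmoothAt (Z i) x) : CSmoothAt (fun y => ∑ i ∈ s, Z i y) x := by
  classical
  induction s using Finset.induction_on with
  | empty => simpa using csmoothAt_zero
  | insert a s ha ih =>
    simp only [Finset.sum_insert ha]
    exact (hZ a (Finset.mem_insert_self a s)).add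
      (ih fun i hi => hZ i (Finset.mem_insert_of_mem hi))

end Algebra

variable [CompleteSpace V] [I.Boundaryless] [IsManifold I ∞ M]
  {Z Z' : Π x : M, ComplexTangentSpace I x} {x : M} {f : M → ℂ}

theorem CSmoothAt.fieldDeriv (hZ : CSmoothAt Z x) (hf : ContMDiffAt I 𝓘(ℝ, ℂ) ∞ f x) :
    ContMDiffAt I 𝓘(ℝ, ℂ) ∞ (fieldDeriv Z f) x :=
  (contMDiffAt_mvfderiv_apply hZ.1 hf).add
    (contMDiffAt_const.cmul (contMDiffAt_mvfderiv_apply hZ.2 hf))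

theorem mvfderiv_fieldDeriv (hZ : CSmoothAt Z x) (hf : ContMDiffAt I 𝓘(ℝ, ℂ) ∞ f x)
    (v : TangentSpace I x) :
    mvfderiv I (fieldDeriv Z f) x v = mvfderiv I (fun y => mvfderiv I f y (cre (Z y))) x v
      + Complex.I * mvfderiv I (fun y => mvfderiv I f y (cim (Z y))) x v := by
  have h1 := (contMDiffAt_mvfderiv_apply hZ.1 hf).mdifferentiableAt (by simp)
  have h2 := (contMDiffAt_mvfderiv_apply hZ.2 hf).mdifferentiableAt (by simp)
  have h3 : MDifferentiableAt I 𝓘(ℝ, ℂ)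
      (fun y => Complex.I * mvfderiv I f y (cim (Z y))) x := mdifferentiableAt_const.mul h2
  have h4 : mvfderiv I (fun y => Complex.I * mvfderiv I f y (cim (Z y))) x v
      = Complex.I * mvfderiv I (fun y => mvfderiv I f y (cim (Z y))) x v := by
    rw [mvfderiv_cmul mdifferentiableAt_const h2, mvfderiv_const]
    simp
  have h6 := DFunLike.congr_fun (mvfderiv_fun_add h1 h3) v
  rw [add_apply, h4] at h6
  exact h6

/-- The complex bilinear extension of the real commutator formula, which is applied to the four
pairs of real and imaginary parts. Brackets are evaluated through this formula in what follows. -/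
theorem cderiv_lieBracket (hZ : CSmoothAt Z x) (hZ' : CSmoothAt Z' x)
    (hf : ContMDiffAt I 𝓘(ℝ, ℂ) ∞ f x) :
    cderiv I f x (lieBracket I Z Z' x) =
      cderiv I (fieldDeriv Z' f) x (Z x) - cderiv I (fieldDeriv Z f) x (Z' x) := by
  simp only [cderiv_apply, mvfderiv_fieldDeriv hZ hf, mvfderiv_fieldDeriv hZ' hf, lieBracket,
    cre_cmk, cim_cmk, map_sub, map_add, mvfderiv_mlieBracket hZ.1 hZ'.1 hf,
    mvfderiv_mlieBracket hZ.2 hZ'.2 hf, mvfderiv_mlieBracket hZ.1 hZ'.2 hf,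
    mvfderiv_mlieBracket hZ.2 hZ'.1 hf]
  ring_nf
  rw [Complex.I_sq]
  ring

-- Locality of the bracket, which permits replacing a section by its product with a cutoff function.
omit [CompleteSpace V] [I.Boundaryless] [IsManifold I ∞ M] in
theorem lieBracket_congr {Z₁ Z₁' : Π x : M, ComplexTangentSpace I x}
    (h : ∀ᶠ y in 𝓝 x, Z y = Z₁ y) (h' : ∀ᶠ y in 𝓝 x, Z' y = Z₁' y) :
    lieBracket I Z Z' x = lieBracket I Z₁ Z₁' x := by
  have key : ∀ {A B A' B' : Π y : M, TangentSpace I y}, (∀ᶠ y in 𝓝 x, A y = A' y) →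
      (∀ᶠ y in 𝓝 x, B y = B' y) →
      VectorField.mlieBracket I A B x = VectorField.mlieBracket I A' B' x :=
    fun hA hB => Filter.EventuallyEq.mlieBracket_vectorField_eq hA hB
  have hr := h.mono fun y hy => congrArg cre hy
  have hi := h.mono fun y hy => congrArg cim hy
  have hr' := h'.mono fun y hy => congrArg cre hy
  have hi' := h'.mono fun y hy => congrArg cim hy
  rw [lieBracket, lieBracket, key hr hr', key hi hi', key hr hi', key hi hr']

end Calculus

theorem dual_baseChange_apply {W : Type*} [AddCommGroup W] [Module ℝ W] (f : W →ₗ[ℝ] ℝ)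
    (z : ℂ ⊗[ℝ] W) :
    Module.Dual.baseChange ℂ f z = (f (cre z) : ℂ) + Complex.I * (f (cim z) : ℂ) := by
  induction z with
  | zero => simp
  | tmul a w =>
    simp only [Module.Dual.baseChange_apply_tmul, cre_tmul, cim_tmul, map_smul, smul_eq_mul,
      Complex.ofReal_mul]
    conv_lhs => rw [← Complex.re_add_im a]
    simp only [Complex.real_smul]
    ring
  | add x y hx hy => simp only [map_add, hx, hy, Complex.ofReal_add]; ring

/-! ### The complex linear extension of the connection -/

section Cov

open scoped Topology

variable {V : Type*} [NormedAddCommGroup V] [NormedSpace ℝ V]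
  {H : Type*} [TopologicalSpace H] {I : ModelWithCorners ℝ V H}
  {M : Type*} [TopologicalSpace M] [ChartedSpace H M] [IsManifold I ∞ M]
  (D : CovariantDerivative I V (TangentSpace I : M → Type _))

/-- The map `z ↦ D_z W` at a point. -/
def covAt (W : Π x : M, ComplexTangentSpace I x) (x : M) :
    ComplexTangentSpace I x →ₗ[ℂ] ComplexTangentSpace I x :=
  (D (fun y => cre (W y)) x).toLinearMap.baseChange ℂ
    + Complex.I • (D (fun y => cim (W y)) x).toLinearMap.baseChange ℂ

theorem cre_covAt (W : Π x : M, ComplexTangentSpace I x) (x : M) (z : ComplexTangentSpace I x) :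
    cre (covAt D W x z) = D (fun y => cre (W y)) x (cre z) - D (fun y => cim (W y)) x (cim z) := by
  simp [covAt, cre_smul, sub_eq_add_neg]

theorem cim_covAt (W : Π x : M, ComplexTangentSpace I x) (x : M) (z : ComplexTangentSpace I x) :
    cim (covAt D W x z) = D (fun y => cim (W y)) x (cre z) + D (fun y => cre (W y)) x (cim z) := by
  simp [covAt, cim_smul, add_comm]

/-- Makes visible that `D_X W` at `x` depends on `X` only through `X x`, and complex linearly. -/
theorem cov_eq (X W : Π x : M, ComplexTangentSpace I x) (x : M) :
    cov D X W x = covAt D W x (X x) :=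
  ext_cre_cim (by rw [cre_covAt, cov, cre_cmk]) (by rw [cim_covAt, cov, cim_cmk])

variable {D}

theorem contMDiffAt_cov_real (hD : D.ContMDiffCovariantDerivative ∞)
    {X W : Π x : M, TangentSpace I x} {x : M}
    (hX : ContMDiffAt I I.tangent ∞ (fun y => (⟨y, X y⟩ : TangentBundle I M)) x)
    (hW : ContMDiff I I.tangent ∞ (fun y => (⟨y, W y⟩ : TangentBundle I M))) :
    ContMDiffAt I I.tangent ∞ (fun y => (⟨y, D W y (X y)⟩ : TangentBundle I M)) x := by
  have h := (hD.contMDiff.contMDiff (σ := W) (contMDiffOn_univ.2 hW))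
  exact ContMDiffAt.clm_bundle_apply (E₁ := fun x : M => TangentSpace I x)
    (E₂ := fun x : M => TangentSpace I x) (contMDiffOn_univ.1 h x) hX

theorem CSmoothAt.cov (hD : D.ContMDiffCovariantDerivative ∞)
    {X W : Π x : M, ComplexTangentSpace I x} {x : M} (hX : CSmoothAt X x)
    (hW : SmoothOn I W Set.univ) : CSmoothAt (cov D X W) x := by
  have hr := contMDiffOn_univ.1 hW.1
  have hi := contMDiffOn_univ.1 hW.2
  refine ⟨?_, ?_⟩
  · simp only [CotangentGC.cov, cre_cmk]
    exact (contMDiffAt_cov_real hD hX.1 hr).sub_section (contMDiffAt_cov_real hD hX.2 hi)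
  · simp only [CotangentGC.cov, cim_cmk]
    exact (contMDiffAt_cov_real hD hX.1 hi).add_section (contMDiffAt_cov_real hD hX.2 hr)

end Cov

/-! ### Fibrewise linear functions on `T*M` and the splitting -/

section Cotangent

open scoped Topology

variable {V : Type*} [NormedAddCommGroup V] [NormedSpace ℝ V]
  {H : Type*} [TopologicalSpace H] {I : ModelWithCorners ℝ V H}
  {M : Type*} [TopologicalSpace M] [ChartedSpace H M] [IsManifold I ∞ M]

/-- The fibrewise linear function on the cotangent manifold defined by a vector field. -/
def realMomentum (W : Π x : M, TangentSpace I x) (γ : CotangentBundle I M) : ℝ := γ.2 (W γ.proj)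

theorem contMDiffAt_realMomentum {W : Π x : M, TangentSpace I x} {γ : CotangentBundle I M}
    (hW : ContMDiffAt I I.tangent ∞ (fun y => (⟨y, W y⟩ : TangentBundle I M)) γ.proj) :
    ContMDiffAt (cotModel I) 𝓘(ℝ, ℝ) ∞ (realMomentum W) γ := by
  have hp : ContMDiffAt (cotModel I) I ∞ (TotalSpace.proj : CotangentBundle I M → M) γ :=
    (Bundle.contMDiff_proj (n := ∞) (IB := I) (fun x : M => CotangentSpace I x)).contMDiffAt
  have h : ContMDiffAt (cotModel I) (I.prod 𝓘(ℝ, ℝ)) ∞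
      (fun m : CotangentBundle I M ↦
        TotalSpace.mk' ℝ (E := Bundle.Trivial M ℝ) m.proj (m.2 (W m.proj))) γ := by
    apply ContMDiffAt.clm_bundle_apply (F₁ := V) (F₂ := ℝ) (E₁ := fun x : M => TangentSpace I x)
    · exact contMDiffAt_id
    · exact hW.comp γ hp
  rw [contMDiffAt_totalSpace] at h
  exact h.2

theorem mdifferentiableAt_realMomentum {W : Π x : M, TangentSpace I x} {γ : CotangentBundle I M}
    (hW : MDiffAt (T% W) γ.proj) :
    MDifferentiableAt (cotModel I) 𝓘(ℝ, ℝ) (realMomentum W) γ := by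
  have h : MDifferentiableAt (cotModel I) (I.prod 𝓘(ℝ, ℝ))
      (fun m : CotangentBundle I M ↦
        TotalSpace.mk' ℝ (E := Bundle.Trivial M ℝ) m.proj (m.2 (W m.proj))) γ := by
    apply MDifferentiableAt.clm_bundle_apply (F₁ := V) (F₂ := ℝ)
      (E₁ := fun x : M => TangentSpace I x)
    · exact mdifferentiableAt_id
    · exact hW.comp γ (mdiff_proj γ)
  simp only [mdifferentiableAt_totalSpace] at h
  exact h.2

/-- On a fibre the momentum is evaluation at `W x`, a linear function, hence its own derivative. -/
theorem mvfderiv_realMomentum_fibre {W : Π x : M, TangentSpace I x} {x : M}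
    (hW : MDiffAt (T% W) x) (η ξ : V →L[ℝ] ℝ) :
    mfderiv (cotModel I) 𝓘(ℝ, ℝ) (realMomentum W) ⟨x, η⟩
      (mfderiv 𝓘(ℝ, V →L[ℝ] ℝ) (cotModel I)
        (fun η : V →L[ℝ] ℝ => (⟨x, η⟩ : CotangentBundle I M)) η ξ) = ξ (W x) := by
  -- Views `W x` as an element of the model space, so that evaluation at it is a continuous linear
  -- map on `V →L[ℝ] ℝ`.
  obtain ⟨w, hw⟩ : ∃ w : V, w = W x := ⟨W x, rfl⟩
  have h := mfderiv_comp_apply (I := 𝓘(ℝ, V →L[ℝ] ℝ)) (I' := cotModel I) (I'' := 𝓘(ℝ, ℝ)) η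
    (g := realMomentum W) (f := fun η : V →L[ℝ] ℝ => (⟨x, η⟩ : CotangentBundle I M))
    (mdifferentiableAt_realMomentum hW) (mdiff_fibre x η) ξ
  have h2 : realMomentum W ∘ (fun η : V →L[ℝ] ℝ => (⟨x, η⟩ : CotangentBundle I M)) =
      ContinuousLinearMap.apply ℝ ℝ w := by rw [hw]; rfl
  rw [h2, ContinuousLinearMap.mfderiv_eq] at h
  refine h.symm.trans ?_
  rw [hw]
  rfl

theorem mvfderiv_realMomentum_vertLift {W : Π x : M, TangentSpace I x} {γ : CotangentBundle I M}
    (hW : MDiffAt (T% W) γ.proj) (ξ : CotangentSpace I γ.proj) :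
    mvfderiv (cotModel I) (realMomentum W) γ (vertLift γ ξ) = ξ (W γ.proj) := by
  obtain ⟨x, η⟩ := γ
  exact mvfderiv_realMomentum_fibre hW η ξ

variable [FiniteDimensional ℝ V] (D : CovariantDerivative I V (TangentSpace I : M → Type _))

/-- Along a 1-form `σ` through `γ` the momentum is `σ(W)`, so `dσ(v)` contributes `v(σ(W))`.
Subtracting the vertical term `(D_v σ)(W) = v(σ(W)) - σ(D_v W)` leaves `γ(D_v W)`. -/
theorem mvfderiv_realMomentum_horLift {W : Π x : M, TangentSpace I x} {γ : CotangentBundle I M}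
    (hW : MDiffAt (T% W) γ.proj) (v : TangentSpace I γ.proj) :
    mvfderiv (cotModel I) (realMomentum W) γ (horLift D γ v) = γ.2 (D W γ.proj v) := by
  have hs : FormDiffAt (extend (V →L[ℝ] ℝ) γ.2) γ.proj := mdifferentiableAt_extend I _ γ.2
  have h3 : formSection (extend (V →L[ℝ] ℝ) γ.2) γ.proj = γ := by simp [formSection]
  have h := mfderiv_comp_apply_of_eq (I := I) (I' := cotModel I) (I'' := 𝓘(ℝ, ℝ)) γ.proj
    (g := realMomentum W) (f := formSection (extend (V →L[ℝ] ℝ) γ.2))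
    (mdifferentiableAt_realMomentum hW) hs h3 v
  have h4 := dualConnection_apply D hs hW v
  have h5 := mvfderiv_realMomentum_vertLift hW
    (dualConnection D (extend (V →L[ℝ] ℝ) γ.2) γ.proj v)
  have h6 : mvfderiv (cotModel I) (realMomentum W) γ (horLift D γ v) =
      mvfderiv (cotModel I) (realMomentum W) γ
      (show TangentSpace (cotModel I) γ from
        mfderiv I (cotModel I) (formSection (extend (V →L[ℝ] ℝ) γ.2)) γ.proj v) -
      mvfderiv (cotModel I) (realMomentum W) γ
        (vertLift γ (dualConnection D (extend (V →L[ℝ] ℝ) γ.2) γ.proj v)) :=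
    ContinuousLinearMap.map_sub (mvfderiv (cotModel I) (realMomentum W) γ) _ _
  rw [h6, h5, h4]
  have h7 : mvfderiv (cotModel I) (realMomentum W) γ
      (show TangentSpace (cotModel I) γ from
        mfderiv I (cotModel I) (formSection (extend (V →L[ℝ] ℝ) γ.2)) γ.proj v) =
      mvfderiv I (fun y => (extend (V →L[ℝ] ℝ) γ.2 y) (W y)) γ.proj v := by
    refine Eq.trans ?_ h.symm
    unfold mvfderiv
    rw [h3]
    rfl
  rw [h7, extend_apply_self]
  ring

theorem mvfderiv_realMomentum_splitting {W : Π x : M, TangentSpace I x} {γ : CotangentBundle I M}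
    (hW : MDiffAt (T% W) γ.proj) (u : GenTangentSpace I γ.proj) :
    mvfderiv (cotModel I) (realMomentum W) γ (splitting D γ u) =
      γ.2 (D W γ.proj u.1) + u.2 (W γ.proj) := by
  have h : mvfderiv (cotModel I) (realMomentum W) γ (splitting D γ u) =
      mvfderiv (cotModel I) (realMomentum W) γ (horLift D γ u.1)
        + mvfderiv (cotModel I) (realMomentum W) γ (vertLift γ u.2) :=
    ContinuousLinearMap.map_add _ _ _
  rw [h, mvfderiv_realMomentum_horLift D hW, mvfderiv_realMomentum_vertLift hW]

theorem dproj_splitting (γ : CotangentBundle I M) (u : GenTangentSpace I γ.proj) :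
    dproj γ (splitting D γ u) = u.1 := by
  have h : dproj γ (splitting D γ u) = dproj γ (horLift D γ u.1) + dproj γ (vertLift γ u.2) :=
    ContinuousLinearMap.map_add _ _ _
  rw [h, dproj_horLift, dproj_vertLift, add_zero]

end Cotangent

theorem ext_iff_cre_cim {W : Type*} [AddCommGroup W] [Module ℝ W] (a b : ℂ ⊗[ℝ] W) :
    a = b ↔ cre a = cre b ∧ cim a = cim b :=
  ⟨fun h => by simp [h], fun h => ext_cre_cim h.1 h.2⟩

/-! ### Complex momenta and the `i`-eigenspace of the induced structure -/

section Momentum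

open scoped Topology

variable {V : Type*} [NormedAddCommGroup V] [NormedSpace ℝ V]
  {H : Type*} [TopologicalSpace H] {I : ModelWithCorners ℝ V H}
  {M : Type*} [TopologicalSpace M] [ChartedSpace H M] [IsManifold I ∞ M]

/-- The complex linear extension of a covector. -/
def evalC {x : M} (ξ : CotangentSpace I x) : ComplexTangentSpace I x →ₗ[ℂ] ℂ :=
  Module.Dual.baseChange ℂ ξ.toLinearMap

omit [IsManifold I ∞ M] in
theorem evalC_apply {x : M} (ξ : CotangentSpace I x) (z : ComplexTangentSpace I x) :
    evalC ξ z = (ξ (cre z) : ℂ) + Complex.I * (ξ (cim z) : ℂ) :=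
  dual_baseChange_apply _ _

omit [IsManifold I ∞ M] in
theorem pairing_eq {x : M} (ξ : ℂ ⊗[ℝ] CotangentSpace I x) (z : ComplexTangentSpace I x) :
    pairing ξ z = evalC (cre ξ) z + Complex.I * evalC (cim ξ) z := rfl

omit [IsManifold I ∞ M] in
theorem eq_zero_of_evalC {x : M} [FiniteDimensional ℝ V] {z : ComplexTangentSpace I x}
    (h : ∀ ξ : CotangentSpace I x, evalC ξ z = 0) : z = 0 := by
  have key : ∀ ξ : CotangentSpace I x, ξ (cre z) = 0 ∧ ξ (cim z) = 0 := by
    intro ξ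
    have := h ξ
    rw [evalC_apply, Complex.ext_iff] at this
    simpa using this
  have hz : ∀ v : V, (∀ ξ : V →L[ℝ] ℝ, ξ v = 0) → v = 0 := by
    intro v hv
    by_contra hne
    obtain ⟨f, hf⟩ := SeparatingDual.exists_ne_zero (R := ℝ) hne
    exact hf (hv f)
  refine ext_cre_cim ?_ ?_
  · rw [map_zero]
    exact hz _ fun ξ => (key ξ).1
  · rw [map_zero]
    exact hz _ fun ξ => (key ξ).2

/-- The fibrewise linear complex function on the cotangent manifold defined by a complex vector
field. -/
def momentum (W : Π x : M, ComplexTangentSpace I x) (γ : CotangentBundle I M) : ℂ :=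
  evalC γ.2 (W γ.proj)

theorem momentum_eq (W : Π x : M, ComplexTangentSpace I x) :
    momentum W = fun γ => (realMomentum (fun x => cre (W x)) γ : ℂ)
      + Complex.I * (realMomentum (fun x => cim (W x)) γ : ℂ) :=
  funext fun _ => evalC_apply _ _

theorem contMDiffAt_ofReal {N : Type*} {H' V' : Type*} [NormedAddCommGroup V'] [NormedSpace ℝ V']
    [TopologicalSpace H'] {J : ModelWithCorners ℝ V' H'} [TopologicalSpace N] [ChartedSpace H' N]
    {f : N → ℝ} {x : N} (hf : ContMDiffAt J 𝓘(ℝ, ℝ) ∞ f x) :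
    ContMDiffAt J 𝓘(ℝ, ℂ) ∞ (fun y => (f y : ℂ)) x :=
  Complex.ofRealCLM.contDiff.contMDiff.contMDiffAt.comp x hf

theorem contMDiffAt_momentum {W : Π x : M, ComplexTangentSpace I x} {γ : CotangentBundle I M}
    (hW : CSmoothAt W γ.proj) : ContMDiffAt (cotModel I) 𝓘(ℝ, ℂ) ∞ (momentum W) γ := by
  rw [momentum_eq]
  exact (contMDiffAt_ofReal (contMDiffAt_realMomentum hW.1)).add
    (contMDiffAt_const.cmul (contMDiffAt_ofReal (contMDiffAt_realMomentum hW.2)))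

theorem mvfderiv_ofReal {N : Type*} {H' V' : Type*} [NormedAddCommGroup V'] [NormedSpace ℝ V']
    [TopologicalSpace H'] {J : ModelWithCorners ℝ V' H'} [TopologicalSpace N] [ChartedSpace H' N]
    {f : N → ℝ} {x : N} (hf : MDifferentiableAt J 𝓘(ℝ, ℝ) f x) (v : TangentSpace J x) :
    mvfderiv J (fun y => (f y : ℂ)) x v = (mvfderiv J f x v : ℂ) := by
  have h := mfderiv_comp_apply (I := J) (I' := 𝓘(ℝ, ℝ)) (I'' := 𝓘(ℝ, ℂ)) x
    (g := Complex.ofRealCLM) (f := f) Complex.ofRealCLM.mdifferentiableAt hf v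
  rw [ContinuousLinearMap.mfderiv_eq] at h
  exact h

theorem mvfderiv_momentum {W : Π x : M, ComplexTangentSpace I x} {γ : CotangentBundle I M}
    (hW : CSmoothAt W γ.proj) (v : TangentSpace (cotModel I) γ) :
    mvfderiv (cotModel I) (momentum W) γ v =
      (mvfderiv (cotModel I) (realMomentum fun x => cre (W x)) γ v : ℂ)
      + Complex.I * (mvfderiv (cotModel I) (realMomentum fun x => cim (W x)) γ v : ℂ) := by
  have h1 := contMDiffAt_realMomentum hW.1
  have h2 := contMDiffAt_realMomentum hW.2
  have h1' := (contMDiffAt_ofReal h1).mdifferentiableAt (by simp)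
  have h2' := (contMDiffAt_ofReal h2).mdifferentiableAt (by simp)
  have h3 : MDifferentiableAt (cotModel I) 𝓘(ℝ, ℂ) (fun γ : CotangentBundle I M =>
      Complex.I * (realMomentum (fun x => cim (W x)) γ : ℂ)) γ := mdifferentiableAt_const.mul h2'
  rw [momentum_eq, mvfderiv_fun_add h1' h3, add_apply,
    mvfderiv_cmul mdifferentiableAt_const h2', mvfderiv_const,
    mvfderiv_ofReal (h1.mdifferentiableAt (by simp)),
    mvfderiv_ofReal (h2.mdifferentiableAt (by simp))]
  simp

/-- The complex linear extension of the differential of the projection. -/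
def projC (γ : CotangentBundle I M) :
    ComplexTangentSpace (cotModel I) γ →ₗ[ℂ] ComplexTangentSpace I γ.proj :=
  (dproj γ).toLinearMap.baseChange ℂ

theorem cderiv_comp_proj {h : M → ℂ} {γ : CotangentBundle I M}
    (hh : MDifferentiableAt I 𝓘(ℝ, ℂ) h γ.proj) (z : ComplexTangentSpace (cotModel I) γ) :
    cderiv (cotModel I) (fun γ : CotangentBundle I M => h γ.proj) γ z =
      cderiv I h γ.proj (projC γ z) := by
  have key : ∀ v : TangentSpace (cotModel I) γ,
      mvfderiv (cotModel I) (fun γ : CotangentBundle I M => h γ.proj) γ v =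
        mvfderiv I h γ.proj (dproj γ v) :=
    fun v => mfderiv_comp_apply (I := cotModel I) (I' := I) (I'' := 𝓘(ℝ, ℂ)) γ
      (g := h) (f := (TotalSpace.proj : CotangentBundle I M → M)) hh (mdiff_proj γ) v
  rw [cderiv_apply, cderiv_apply, key, key, projC, cre_baseChange, cim_baseChange]
  rfl

theorem contMDiffAt_comp_proj {h : M → ℂ} {γ : CotangentBundle I M}
    (hh : ContMDiffAt I 𝓘(ℝ, ℂ) ∞ h γ.proj) :
    ContMDiffAt (cotModel I) 𝓘(ℝ, ℂ) ∞ (fun γ : CotangentBundle I M => h γ.proj) γ := by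
  have hp : ContMDiffAt (cotModel I) I ∞ (TotalSpace.proj : CotangentBundle I M → M) γ :=
    (Bundle.contMDiff_proj (n := ∞) (IB := I) (fun x : M => CotangentSpace I x)).contMDiffAt
  exact hh.comp γ hp

variable [FiniteDimensional ℝ V] (D : CovariantDerivative I V (TangentSpace I : M → Type _))

/-- The vertical part of a complex tangent vector to the cotangent manifold. -/
def vertC (γ : CotangentBundle I M) :
    ComplexTangentSpace (cotModel I) γ →ₗ[ℂ] ℂ ⊗[ℝ] CotangentSpace I γ.proj :=
  (LinearMap.snd ℝ (TangentSpace I γ.proj) (CotangentSpace I γ.proj)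
    ∘ₗ (splitting D γ).symm.toLinearMap).baseChange ℂ

/-- The formula through which the connection enters: the vertical part of `z` can be read off from
the derivatives of momenta once `projC γ z` is known. -/
theorem cderiv_momentum {W : Π x : M, ComplexTangentSpace I x} {γ : CotangentBundle I M}
    (hW : CSmoothAt W γ.proj) (z : ComplexTangentSpace (cotModel I) γ) :
    cderiv (cotModel I) (momentum W) γ z =
      evalC γ.2 (covAt D W γ.proj (projC γ z)) + pairing (vertC D γ z) (W γ.proj) := by
  have key : ∀ {Y : Π x : M, TangentSpace I x},
      ContMDiffAt I I.tangent ∞ (fun y => (⟨y, Y y⟩ : TangentBundle I M)) γ.proj →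
      ∀ v : TangentSpace (cotModel I) γ, mvfderiv (cotModel I) (realMomentum Y) γ v =
        γ.2 (D Y γ.proj (dproj γ v)) + ((splitting D γ).symm v).2 (Y γ.proj) := by
    intro Y hY v
    obtain ⟨u, rfl⟩ := (splitting D γ).surjective v
    rw [mvfderiv_realMomentum_splitting D (hY.mdifferentiableAt (by simp)),
      dproj_splitting, LinearEquiv.symm_apply_apply]
  simp only [cderiv_apply, mvfderiv_momentum hW, key hW.1, key hW.2, pairing_eq, evalC_apply,
    cre_covAt, cim_covAt, projC, vertC, cre_baseChange, cim_baseChange, LinearMap.comp_apply,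
    LinearMap.snd_apply, LinearEquiv.coe_coe, ContinuousLinearMap.coe_coe, map_sub, map_add,
    Complex.ofReal_add, Complex.ofReal_sub]
  ring_nf
  rw [Complex.I_sq]
  ring

theorem mem_holomorphicSpace_conj {W W' : Type*} [AddCommGroup W] [Module ℝ W] [AddCommGroup W']
    [Module ℝ W'] (e : W ≃ₗ[ℝ] W') (J : W →ₗ[ℝ] W) (z : ℂ ⊗[ℝ] W') :
    z ∈ holomorphicSpace (e.conj J) ↔ e.symm.toLinearMap.baseChange ℂ z ∈ holomorphicSpace J := by
  simp only [holomorphicSpace, Module.End.mem_eigenspace_iff]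
  have h2 : ∀ a b : W', a = b ↔ e.symm a = e.symm b := fun a b => e.symm.injective.eq_iff.symm
  rw [ext_iff_cre_cim, ext_iff_cre_cim]
  simp only [cre_baseChange, cim_baseChange, cre_smul, cim_smul]
  rw [h2, h2 (e.conj J (cim z))]
  simp [LinearEquiv.conj_apply]

/-- The hypothesis `hL` describes `L^τ(E, α)` with an arbitrary `F` in place of `τ(E)` and a form
`A` on the whole tangent space in place of `α`. This removes both `τ` and the dependent domains from
the later arguments. -/
theorem mem_holomorphicSpace_inducedACS
    {𝒥 : Π x : M, GenTangentSpace I x →L[ℝ] GenTangentSpace I x}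
    {E F : Π x : M, Submodule ℂ (ComplexTangentSpace I x)}
    {A : Π x : M, ComplexTangentSpace I x →ₗ[ℂ] ComplexTangentSpace I x →ₗ[ℂ] ℂ}
    (hL : ∀ (x : M) (l : ℂ ⊗[ℝ] GenTangentSpace I x),
      l ∈ holomorphicSpace (𝒥 x).toLinearMap ↔
      (LinearMap.fst ℝ (TangentSpace I x) (CotangentSpace I x)).baseChange ℂ l ∈ E x ∧
      ∀ w ∈ F x, pairing ((LinearMap.snd ℝ (TangentSpace I x) (CotangentSpace I x)).baseChange ℂ l) w
        = A x ((LinearMap.fst ℝ (TangentSpace I x) (CotangentSpace I x)).baseChange ℂ l) w)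
    (γ : CotangentBundle I M) (z : ComplexTangentSpace (cotModel I) γ) :
    z ∈ holomorphicSpace (inducedACS 𝒥 D γ) ↔
      projC γ z ∈ E γ.proj ∧ ∀ w ∈ F γ.proj, pairing (vertC D γ z) w = A γ.proj (projC γ z) w := by
  have h1 : (LinearMap.fst ℝ (TangentSpace I γ.proj) (CotangentSpace I γ.proj)).baseChange ℂ
      ((splitting D γ).symm.toLinearMap.baseChange ℂ z) = projC γ z := by
    have key : ∀ v, ((splitting D γ).symm v).1 = dproj γ v := by
      intro v
      obtain ⟨u, rfl⟩ := (splitting D γ).surjective v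
      rw [dproj_splitting, LinearEquiv.symm_apply_apply]
    refine ext_cre_cim ?_ ?_
    · rw [projC, cre_baseChange, cre_baseChange, cre_baseChange]
      exact key _
    · rw [projC, cim_baseChange, cim_baseChange, cim_baseChange]
      exact key _
  have h2 : (LinearMap.snd ℝ (TangentSpace I γ.proj) (CotangentSpace I γ.proj)).baseChange ℂ
      ((splitting D γ).symm.toLinearMap.baseChange ℂ z) = vertC D γ z := by
    refine ext_cre_cim ?_ ?_
    · rw [vertC, cre_baseChange, cre_baseChange, cre_baseChange]
      rfl
    · rw [vertC, cim_baseChange, cim_baseChange, cim_baseChange]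
      rfl
  rw [inducedACS, mem_holomorphicSpace_conj, hL, h1, h2]

end Momentum

/-! ### Sections and functions with prescribed values at a point -/

section Existence

open scoped Topology

variable {V : Type*} [NormedAddCommGroup V] [NormedSpace ℝ V]
  {H : Type*} [TopologicalSpace H] {I : ModelWithCorners ℝ V H}
  {M : Type*} [TopologicalSpace M] [ChartedSpace H M] [IsManifold I ∞ M]

theorem smoothOn_cutoff_smul {Z : Π x : M, ComplexTangentSpace I x} {U : Set M} {χ : M → ℂ}
    (hχ : ∀ x, ContMDiffAt I 𝓘(ℝ, ℂ) ∞ χ x) (hχ0 : ∀ x ∉ U, ∀ᶠ y in 𝓝 x, χ y = 0)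
    (hZ : ∀ x ∈ U, CSmoothAt Z x) : SmoothOn I (fun x => χ x • Z x) Set.univ := by
  rw [smoothOn_univ_iff]
  intro x
  by_cases hx : x ∈ U
  · exact (hZ x hx).smul (hχ x)
  · refine csmoothAt_zero.congr ?_
    filter_upwards [hχ0 x hx] with y hy
    rw [hy, zero_smul]

variable {E : Π x : M, Submodule ℂ (ComplexTangentSpace I x)}

theorem IsSection.sum {ι : Type*} (s : Finset ι) {Z : ι → Π x : M, ComplexTangentSpace I x}
    (hZ : ∀ i ∈ s, IsSection I E (Z i)) : IsSection I E (fun x => ∑ i ∈ s, Z i x) :=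
  ⟨smoothOn_univ_iff.2 fun x => CSmoothAt.sum s fun i hi => smoothOn_univ_iff.1 (hZ i hi).smooth x,
    fun x => Submodule.sum_mem _ fun i hi => (hZ i hi).mem x⟩

theorem IsSection.smul {Z : Π x : M, ComplexTangentSpace I x} {f : M → ℂ}
    (hf : ∀ x, ContMDiffAt I 𝓘(ℝ, ℂ) ∞ f x) (hZ : IsSection I E Z) :
    IsSection I E (fun x => f x • Z x) :=
  ⟨smoothOn_univ_iff.2 fun x => (smoothOn_univ_iff.1 hZ.smooth x).smul (hf x),
    fun x => Submodule.smul_mem _ _ (hZ.mem x)⟩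

theorem IsSection.csmoothAt {Z : Π x : M, ComplexTangentSpace I x} (hZ : IsSection I E Z) (x : M) :
    CSmoothAt Z x :=
  smoothOn_univ_iff.1 hZ.smooth x

variable [FiniteDimensional ℝ V] [T2Space M]

variable (I) in
/-- A complex valued cutoff function that is `1` near `x₀` and vanishes near every point outside
a given neighbourhood of `x₀`. -/
theorem exists_cutoff {x₀ : M} {U : Set M} (hU : U ∈ 𝓝 x₀) :
    ∃ χ : M → ℂ, (∀ x, ContMDiffAt I 𝓘(ℝ, ℂ) ∞ χ x) ∧ (∀ᶠ x in 𝓝 x₀, χ x = 1) ∧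
      ∀ x ∉ U, ∀ᶠ y in 𝓝 x, χ y = 0 := by
  obtain ⟨f, -, hf⟩ := (SmoothBumpFunction.nhds_basis_tsupport (I := I) x₀).mem_iff.1 hU
  refine ⟨fun x => (f x : ℂ), fun x => contMDiffAt_ofReal f.contMDiff.contMDiffAt, ?_, ?_⟩
  · filter_upwards [f.eventuallyEq_one] with x hx
    simp [hx]
  · intro x hx
    have h : x ∉ tsupport f := fun h => hx (hf h)
    filter_upwards [notMem_tsupport_iff_eventuallyEq.1 h] with y hy
    simp [hy]

/-- Sections are global by definition, so a local frame is multiplied by a cutoff function; it is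
unchanged near `x₀`. -/
theorem IsSubbundle.exists_frame (hE : IsSubbundle I E) (x₀ : M) :
    ∃ (r : ℕ) (e : Fin r → Π x : M, ComplexTangentSpace I x), (∀ i, IsSection I E (e i)) ∧
      ∀ᶠ x in 𝓝 x₀, LinearIndependent ℂ (fun i => e i x) ∧
        Submodule.span ℂ (Set.range fun i => e i x) = E x := by
  obtain ⟨U, hU, hx₀, r, Z, hZ, hspan⟩ := hE x₀
  obtain ⟨χ, hχ, hχ1, hχ0⟩ := exists_cutoff I (hU.mem_nhds hx₀)
  refine ⟨r, fun i x => χ x • Z i x, fun i => ⟨smoothOn_cutoff_smul hχ hχ0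
    fun x hx => (hZ i).csmoothAt (hU.mem_nhds hx), fun x => ?_⟩, ?_⟩
  · by_cases hx : x ∈ U
    · rw [← (hspan x hx).2]
      exact Submodule.smul_mem _ _ (Submodule.subset_span ⟨i, rfl⟩)
    · change χ x • Z i x ∈ E x
      rw [(hχ0 x hx).self_of_nhds, zero_smul]
      exact zero_mem _
  · filter_upwards [hU.mem_nhds hx₀, hχ1] with x hx h1
    simpa [h1] using hspan x hx

theorem IsSubbundle.exists_section (hE : IsSubbundle I E) {x₀ : M} {w : ComplexTangentSpace I x₀}
    (hw : w ∈ E x₀) : ∃ W, IsSection I E W ∧ W x₀ = w := by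
  obtain ⟨r, e, he, hspan⟩ := hE.exists_frame x₀
  rw [← hspan.self_of_nhds.2, Submodule.mem_span_range_iff_exists_fun] at hw
  obtain ⟨c, rfl⟩ := hw
  exact ⟨fun x => ∑ i, c i • e i x,
    IsSection.sum _ fun i _ => (he i).smul fun x => contMDiffAt_const, rfl⟩

/-- A linear function of the chart coordinates, cut off, realises any complex covector as a
differential. -/
theorem exists_function_cderiv_eq {x₀ : M} (B : ComplexTangentSpace I x₀ →ₗ[ℂ] ℂ) :
    ∃ h : M → ℂ, (∀ x, ContMDiffAt I 𝓘(ℝ, ℂ) ∞ h x) ∧ cderiv I h x₀ = B := by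
  have : IsManifold I 1 M := IsManifold.of_le (n := ∞) (by simp)
  have hs : (extChartAt I x₀).source ∈ 𝓝 x₀ := extChartAt_source_mem_nhds x₀
  obtain ⟨χ, hχ, hχ1, hχ0⟩ := exists_cutoff I hs
  have hinv := isInvertible_mfderiv_extChartAt (I := I) (mem_extChartAt_source (I := I) x₀)
  obtain ⟨L, hL⟩ := hinv
  -- Composed with the inverse of the differential `L` of the chart, so that the chain rule returns
  -- `B` itself.
  let b : V →L[ℝ] ℂ := LinearMap.toContinuousLinearMap
    (show V →ₗ[ℝ] ℂ from restrictReal B ∘ₗ L.symm.toLinearEquiv.toLinearMap)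
  have hbs : ∀ x ∈ (extChartAt I x₀).source,
      ContMDiffAt I 𝓘(ℝ, ℂ) ∞ (fun y => b (extChartAt I x₀ y)) x := fun x hx =>
    b.contDiff.contMDiff.contMDiffAt.comp x (contMDiffAt_extChartAt' (by simpa using hx))
  refine ⟨fun x => χ x * b (extChartAt I x₀ x), fun x => ?_, ?_⟩
  · by_cases hx : x ∈ (extChartAt I x₀).source
    · exact (hχ x).cmul (hbs x hx)
    · refine (contMDiffAt_const (c := (0 : ℂ))).congr_of_eventuallyEq ?_
      filter_upwards [hχ0 x hx] with y hy
      rw [hy, zero_mul]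
  · have h1 : (fun x => χ x * b (extChartAt I x₀ x)) =ᶠ[𝓝 x₀] fun x => b (extChartAt I x₀ x) := by
      filter_upwards [hχ1] with y hy
      rw [hy, one_mul]
    rw [cderiv_congr h1]
    have h2 : (mvfderiv I (fun x => b (extChartAt I x₀ x)) x₀).toLinearMap = restrictReal B := by
      refine LinearMap.ext fun v => ?_
      have h3 := mfderiv_comp_apply (I := I) (I' := 𝓘(ℝ, V)) (I'' := 𝓘(ℝ, ℂ)) x₀
        (g := b) (f := extChartAt I x₀) b.mdifferentiableAt
        ((contMDiffAt_extChartAt (I := I) (n := 1) (x := x₀)).mdifferentiableAt (by simp)) v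
      rw [ContinuousLinearMap.mfderiv_eq] at h3
      refine h3.trans ?_
      have h4 : mfderiv I 𝓘(ℝ, V) (extChartAt I x₀) x₀ v = L v := by rw [← hL]; rfl
      refine (congrArg b h4).trans ?_
      exact congrArg (restrictReal B) (L.symm_apply_apply v)
    rw [cderiv, h2, complexify_restrictReal]

/-- Such functions extract coefficients with respect to a frame: differentiating them yields a
linear system whose matrix is the identity at `x₀`, hence invertible nearby. -/
theorem exists_dual_functions {x₀ : M} {r : ℕ} {e : Fin r → ComplexTangentSpace I x₀}
    (he : LinearIndependent ℂ e) :
    ∃ h : Fin r → M → ℂ, (∀ k x, ContMDiffAt I 𝓘(ℝ, ℂ) ∞ (h k) x) ∧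
      ∀ k j, cderiv I (h k) x₀ (e j) = if k = j then 1 else 0 := by
  have key : ∀ k : Fin r, ∃ B : ComplexTangentSpace I x₀ →ₗ[ℂ] ℂ,
      ∀ j, B (e j) = if k = j then 1 else 0 := by
    intro k
    obtain ⟨B, hB⟩ := LinearMap.exists_extend (Finsupp.lapply k ∘ₗ he.repr)
    refine ⟨B, fun j => ?_⟩
    have h1 := LinearMap.congr_fun hB ⟨e j, Submodule.subset_span ⟨j, rfl⟩⟩
    have h2 : he.repr ⟨e j, Submodule.subset_span ⟨j, rfl⟩⟩ = Finsupp.single j 1 :=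
      he.repr_eq_single j _ rfl
    simp only [LinearMap.comp_apply, Submodule.subtype_apply,
      Finsupp.lapply_apply] at h1
    rw [h1]
    erw [h2]
    simp [Finsupp.single_apply, eq_comm]
  choose B hB using key
  choose h hh hd using fun k => exists_function_cderiv_eq (B k)
  exact ⟨h, hh, fun k j => by rw [hd, hB]⟩

end Existence

/-! ### Smooth solutions of linear systems -/

section LinearSystem

open scoped Topology

variable {V : Type*} [NormedAddCommGroup V] [NormedSpace ℝ V]
  {H : Type*} [TopologicalSpace H] {I : ModelWithCorners ℝ V H}
  {N : Type*} [TopologicalSpace N] [ChartedSpace H N]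

theorem contMDiffAt_cprod {ι : Type*} (s : Finset ι) {f : ι → N → ℂ} {x : N}
    (hf : ∀ i ∈ s, ContMDiffAt I 𝓘(ℝ, ℂ) ∞ (f i) x) :
    ContMDiffAt I 𝓘(ℝ, ℂ) ∞ (fun y => ∏ i ∈ s, f i y) x := by
  classical
  induction s using Finset.induction_on with
  | empty => simpa using contMDiffAt_const
  | insert a s ha ih =>
    simp only [Finset.prod_insert ha]
    exact (hf a (Finset.mem_insert_self a s)).cmul
      (ih fun i hi => hf i (Finset.mem_insert_of_mem hi))

theorem contMDiffAt_det {r : ℕ} {m : N → Matrix (Fin r) (Fin r) ℂ} {x : N}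
    (hm : ∀ i j, ContMDiffAt I 𝓘(ℝ, ℂ) ∞ (fun y => m y i j) x) :
    ContMDiffAt I 𝓘(ℝ, ℂ) ∞ (fun y => (m y).det) x := by
  simp only [Matrix.det_apply']
  exact contMDiffAt_sum _ fun σ _ => contMDiffAt_const.cmul (contMDiffAt_cprod _ fun i _ => hm _ _)

/-- Cramer's rule near a point where the determinant is `1`. Both directions of the equivalence
matter: uniqueness shows that given coefficients are smooth, existence produces a functional with
given values. -/
theorem exists_smooth_solution_matrix {r : ℕ} {m : N → Matrix (Fin r) (Fin r) ℂ} {b : Fin r → N → ℂ}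
    {p : N} (hm : ∀ i j x, ContMDiffAt I 𝓘(ℝ, ℂ) ∞ (fun y => m y i j) x)
    (hb : ∀ i x, ContMDiffAt I 𝓘(ℝ, ℂ) ∞ (b i) x) (hp : m p = 1) :
    ∃ c : Fin r → N → ℂ, ∀ᶠ q in 𝓝 p, (∀ i, ContMDiffAt I 𝓘(ℝ, ℂ) ∞ (c i) q) ∧
      ∀ a : Fin r → ℂ, (∀ k, ∑ j, m q k j * a j = b k q) ↔ ∀ j, a j = c j q := by
  refine ⟨fun i q => ∑ k, ((m q).det)⁻¹ * (m q).adjugate i k * b k q, ?_⟩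
  have hdet : ∀ x, ContMDiffAt I 𝓘(ℝ, ℂ) ∞ (fun y => (m y).det) x :=
    fun x => contMDiffAt_det fun i j => hm i j x
  have hne : ∀ᶠ q in 𝓝 p, (m q).det ≠ 0 :=
    (hdet p).continuousAt.eventually_ne (by rw [hp]; simp)
  filter_upwards [hne] with q hq
  have hinv : ∀ i k, (m q)⁻¹ i k = ((m q).det)⁻¹ * (m q).adjugate i k := by
    intro i k
    rw [Matrix.inv_def, Ring.inverse_eq_inv', Matrix.smul_apply, smul_eq_mul]
  refine ⟨fun i => contMDiffAt_sum _ fun k _ => (ContMDiffAt.cmul ?_ ?_).cmul (hb k q), ?_⟩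
  · exact (contDiffAt_inv ℝ hq).contMDiffAt.comp q (hdet q)
  -- An entry of the adjugate is the determinant of `m` with one row replaced by a constant one,
  -- hence smooth.
  · simp only [Matrix.adjugate_apply]
    refine contMDiffAt_det fun i' j' => ?_
    by_cases h : i' = k
    · subst h
      simpa using contMDiffAt_const
    · simpa [Matrix.updateRow_ne h] using hm i' j' q
  · intro a
    have hu : IsUnit (m q).det := isUnit_iff_ne_zero.2 hq
    have h1 : (∀ k, ∑ j, m q k j * a j = b k q) ↔ (m q).mulVec a = fun k => b k q :=
      ⟨fun h => funext fun k => h k, fun h k => congrFun h k⟩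
    have h2 : (∀ j, a j = ∑ k, ((m q).det)⁻¹ * (m q).adjugate j k * b k q) ↔
        a = (m q)⁻¹.mulVec fun k => b k q := by
      simp only [← hinv]
      exact ⟨fun h => funext fun k => h k, fun h k => congrFun h k⟩
    rw [h1, h2]
    constructor
    · intro h
      rw [← h, Matrix.mulVec_mulVec, Matrix.nonsing_inv_mul _ hu, Matrix.one_mulVec]
    · intro h
      rw [h, Matrix.mulVec_mulVec, Matrix.mul_nonsing_inv _ hu, Matrix.one_mulVec]

/-- Solutions of smooth linear systems are smooth near a point at which the matrix of the system is
the identity. -/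
theorem exists_smooth_solution {r : ℕ} {m : Fin r → Fin r → N → ℂ} {b : Fin r → N → ℂ}
    {p : N} (hm : ∀ i j x, ContMDiffAt I 𝓘(ℝ, ℂ) ∞ (m i j) x)
    (hb : ∀ i x, ContMDiffAt I 𝓘(ℝ, ℂ) ∞ (b i) x) (hp : ∀ i j, m i j p = if i = j then 1 else 0) :
    ∃ c : Fin r → N → ℂ, ∀ᶠ q in 𝓝 p, (∀ i, ContMDiffAt I 𝓘(ℝ, ℂ) ∞ (c i) q) ∧
      ∀ a : Fin r → ℂ, (∀ k, ∑ j, m k j q * a j = b k q) ↔ ∀ j, a j = c j q :=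
  exists_smooth_solution_matrix (m := fun q => Matrix.of fun i j => m i j q) hm hb
    (Matrix.ext fun i j => (hp i j).trans (Matrix.one_apply).symm)

end LinearSystem

/-! ### Brackets of fields acting through finitely many functions -/

section BracketExpansion

open scoped Topology

variable {V : Type*} [NormedAddCommGroup V] [NormedSpace ℝ V] [CompleteSpace V]
  {H : Type*} [TopologicalSpace H] {I : ModelWithCorners ℝ V H} [I.Boundaryless]
  {N : Type*} [TopologicalSpace N] [ChartedSpace H N] [IsManifold I ∞ N]

/-- The derivative of `f` along a bracket `[Z, Z']`, when `Z` and `Z'` act on `f` and on its first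
derivatives through combinations of finitely many functions. -/
theorem cderiv_lieBracket_of_sum {Z Z' : Π x : N, ComplexTangentSpace I x} {p : N} {f : N → ℂ}
    {r : ℕ} {c c' F : Fin r → N → ℂ} {G : Fin r → Fin r → ℂ}
    (hZ : CSmoothAt Z p) (hZ' : CSmoothAt Z' p) (hf : ContMDiffAt I 𝓘(ℝ, ℂ) ∞ f p)
    (hc : ∀ j, ContMDiffAt I 𝓘(ℝ, ℂ) ∞ (c j) p) (hc' : ∀ j, ContMDiffAt I 𝓘(ℝ, ℂ) ∞ (c' j) p)
    (hF : ∀ j, ContMDiffAt I 𝓘(ℝ, ℂ) ∞ (F j) p)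
    (hfZ : ∀ᶠ q in 𝓝 p, cderiv I f q (Z q) = ∑ j, c j q * F j q)
    (hfZ' : ∀ᶠ q in 𝓝 p, cderiv I f q (Z' q) = ∑ j, c' j q * F j q)
    (hG : ∀ j, cderiv I (F j) p (Z p) = ∑ i, c i p * G i j)
    (hG' : ∀ j, cderiv I (F j) p (Z' p) = ∑ i, c' i p * G i j) :
    cderiv I f p (lieBracket I Z Z' p) =
      ∑ j, (cderiv I (c' j) p (Z p) - cderiv I (c j) p (Z' p)) * F j p
        + ∑ i, ∑ j, c i p * c' j p * (G i j - G j i) := by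
  have hd : ∀ {g : N → ℂ}, ContMDiffAt I 𝓘(ℝ, ℂ) ∞ g p → MDifferentiableAt I 𝓘(ℝ, ℂ) g p :=
    fun h => h.mdifferentiableAt (by simp)
  -- The expansion of `Y f` is differentiated again by the Leibniz rule, so it must hold near `p`;
  -- the derivatives of the `F j` are needed only at `p`.
  have key : ∀ {Y : Π x : N, ComplexTangentSpace I x} {a : Fin r → N → ℂ},
      (∀ j, ContMDiffAt I 𝓘(ℝ, ℂ) ∞ (a j) p) →
      (∀ᶠ q in 𝓝 p, cderiv I f q (Y q) = ∑ j, a j q * F j q) →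
      cderiv I (fieldDeriv Y f) p = ∑ j, (a j p • cderiv I (F j) p + F j p • cderiv I (a j) p) := by
    intro Y a ha hY
    have h1 : fieldDeriv Y f =ᶠ[𝓝 p] fun q => ∑ j, a j q * F j q := by
      filter_upwards [hY] with q hq
      rw [fieldDeriv_eq, hq]
    rw [cderiv_congr h1, cderiv_sum _ fun j _ => hd ((ha j).cmul (hF j))]
    exact Finset.sum_congr rfl fun j _ => cderiv_mul (hd (ha j)) (hd (hF j))
  rw [cderiv_lieBracket hZ hZ' hf, key hc' hfZ', key hc hfZ]
  simp only [LinearMap.sum_apply, LinearMap.add_apply, LinearMap.smul_apply, smul_eq_mul, hG, hG',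
    Finset.sum_add_distrib, sub_mul, mul_sub, Finset.sum_sub_distrib, Finset.mul_sum]
  rw [Finset.sum_comm (f := fun i j => c i p * c' j p * G j i),
    Finset.sum_comm (f := fun i j => c i p * c' j p * G i j)]
  have e1 : ∀ i j, c' i p * (c j p * G j i) = c j p * c' i p * G j i := fun i j => by ring
  have e2 : ∀ i j, c i p * (c' j p * G j i) = c i p * c' j p * G j i := fun i j => by ring
  have e3 : ∀ j, F j p * cderiv I (c' j) p (Z p) = cderiv I (c' j) p (Z p) * F j p :=
    fun j => mul_comm _ _
  have e4 : ∀ j, F j p * cderiv I (c j) p (Z' p) = cderiv I (c j) p (Z' p) * F j p :=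
    fun j => mul_comm _ _
  simp only [e1, e2, e3, e4]
  rw [Finset.sum_comm (f := fun i j => c i p * c' j p * G j i)]
  ring

end BracketExpansion

/-! ### Sufficiency: the structure equations imply involutivity of the lift -/

section Core

open scoped Topology

variable {V : Type*} [NormedAddCommGroup V] [NormedSpace ℝ V] [FiniteDimensional ℝ V]
  {H : Type*} [TopologicalSpace H] {I : ModelWithCorners ℝ V H}
  {M : Type*} [TopologicalSpace M] [ChartedSpace H M] [IsManifold I ∞ M]
  (D : CovariantDerivative I V (TangentSpace I : M → Type _))
  (E F : Π x : M, Submodule ℂ (ComplexTangentSpace I x))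
  (A : Π x : M, ComplexTangentSpace I x →ₗ[ℂ] ComplexTangentSpace I x →ₗ[ℂ] ℂ)

/-- The lift to the cotangent manifold, by means of `D`, of the distribution of all `X + ξ` with
`X ∈ E` and `ξ = A(X, ·)` on `F`. -/
def InLift (γ : CotangentBundle I M) (z : ComplexTangentSpace (cotModel I) γ) : Prop :=
  projC γ z ∈ E γ.proj ∧ ∀ w ∈ F γ.proj, pairing (vertC D γ z) w = A γ.proj (projC γ z) w

variable {D E F A}

theorem InLift.cderiv_momentum {γ : CotangentBundle I M} {z : ComplexTangentSpace (cotModel I) γ}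
    (hz : InLift D E F A γ z) {W : Π x : M, ComplexTangentSpace I x} (hW : IsSection I F W) :
    cderiv (cotModel I) (momentum W) γ z =
      evalC γ.2 (covAt D W γ.proj (projC γ z)) + A γ.proj (projC γ z) (W γ.proj) := by
  rw [CotangentGC.cderiv_momentum D (hW.csmoothAt _), hz.2 _ (hW.mem _)]

/-- Momenta of sections of `F` suffice to detect the lifted distribution: each `w ∈ F` extends to a
section, and the term `γ(D W)` occurs on both sides. -/
theorem inLift_of_cderiv_momentum [T2Space M] (hF : IsSubbundle I F) {γ : CotangentBundle I M}
    {z : ComplexTangentSpace (cotModel I) γ} (hz : projC γ z ∈ E γ.proj)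
    (h : ∀ W, IsSection I F W → cderiv (cotModel I) (momentum W) γ z =
      evalC γ.2 (covAt D W γ.proj (projC γ z)) + A γ.proj (projC γ z) (W γ.proj)) :
    InLift D E F A γ z := by
  refine ⟨hz, fun w hw => ?_⟩
  obtain ⟨W, hW, rfl⟩ := hF.exists_section hw
  have := h W hW
  rw [CotangentGC.cderiv_momentum D (hW.csmoothAt _)] at this
  exact add_left_cancel this

variable [T2Space M] [I.Boundaryless]

/-- A section of the lift need not be projectable, so the coefficients are functions on `T*M`. They
solve the system obtained by applying `Z` to the pullbacks of functions `h k` dual to the frame,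
which makes them smooth. -/
theorem exists_coefficients {Z : Π γ : CotangentBundle I M, ComplexTangentSpace (cotModel I) γ}
    (hZ : ∀ γ, CSmoothAt Z γ) (hZE : ∀ γ, projC γ (Z γ) ∈ E γ.proj) (γ₀ : CotangentBundle I M)
    {r : ℕ} {e : Fin r → Π x : M, ComplexTangentSpace I x} (he : ∀ i, IsSection I E (e i))
    (hspan : ∀ᶠ x in 𝓝 γ₀.proj, LinearIndependent ℂ (fun i => e i x) ∧
        Submodule.span ℂ (Set.range fun i => e i x) = E x) :
    ∃ c : Fin r → CotangentBundle I M → ℂ,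
      (∀ j, ContMDiffAt (cotModel I) 𝓘(ℝ, ℂ) ∞ (c j) γ₀) ∧
      ∀ᶠ γ in 𝓝 γ₀, projC γ (Z γ) = ∑ j, c j γ • e j γ.proj := by
  obtain ⟨h, hh, hdual⟩ := exists_dual_functions hspan.self_of_nhds.1
  have hm : ∀ i j (γ : CotangentBundle I M), ContMDiffAt (cotModel I) 𝓘(ℝ, ℂ) ∞
      (fun γ : CotangentBundle I M => fieldDeriv (e j) (h i) γ.proj) γ :=
    fun i j γ => contMDiffAt_comp_proj (((he j).csmoothAt _).fieldDeriv (hh i _))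
  have hb : ∀ k (γ : CotangentBundle I M), ContMDiffAt (cotModel I) 𝓘(ℝ, ℂ) ∞
      (fieldDeriv Z (fun γ : CotangentBundle I M => h k γ.proj)) γ :=
    fun k γ => (hZ γ).fieldDeriv (contMDiffAt_comp_proj (hh k _))
  obtain ⟨c, hc⟩ := exists_smooth_solution (p := γ₀) hm hb
    fun k j => (fieldDeriv_eq (e j) (h k) γ₀.proj).trans (hdual k j)
  refine ⟨c, hc.self_of_nhds.1, ?_⟩
  have hpr : Filter.Tendsto (TotalSpace.proj : CotangentBundle I M → M) (𝓝 γ₀) (𝓝 γ₀.proj) :=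
    (FiberBundle.continuous_proj _ _).tendsto γ₀
  filter_upwards [hc, hpr.eventually hspan] with γ hγ hs
  have h1 := hZE γ
  rw [← hs.2, Submodule.mem_span_range_iff_exists_fun] at h1
  obtain ⟨a, ha⟩ := h1
  -- The pointwise coefficients `a` solve the system, so by uniqueness they coincide with the smooth
  -- solution `c`.
  have h2 := (hγ.2 a).1 fun k => by
    rw [fieldDeriv_eq, cderiv_comp_proj ((hh k _).mdifferentiableAt (by simp)), ← ha]
    simp [fieldDeriv_eq, mul_comm]
  rw [← ha]
  exact Finset.sum_congr rfl fun j _ => by rw [h2 j]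

omit [FiniteDimensional ℝ V] [T2Space M] [I.Boundaryless] in
/-- The `τ`-free form of the torsion equation. -/
theorem covForm_identity (X Y W : Π x : M, ComplexTangentSpace I x) (x : M) :
    covForm D A X Y W x - covForm D A Y X W x + A x (torsion D X Y x) (W x) =
      cderiv I (fun y => A y (Y y) (W y)) x (X x) - cderiv I (fun y => A y (X y) (W y)) x (Y x)
        - A x (Y x) (cov D X W x) + A x (X x) (cov D Y W x) - A x (lieBracket I X Y x) (W x) := by
  simp only [covForm, torsion, fieldDeriv_eq, map_sub, LinearMap.sub_apply]
  ring

-- The differentials of smooth functions exhaust the complex dual, which separates points.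
omit [I.Boundaryless] in
theorem eq_of_cderiv_eq {x : M} {z w : ComplexTangentSpace I x}
    (h : ∀ f : M → ℂ, (∀ y, ContMDiffAt I 𝓘(ℝ, ℂ) ∞ f y) → cderiv I f x z = cderiv I f x w) :
    z = w := by
  rw [← sub_eq_zero, ← Module.forall_dual_apply_eq_zero_iff ℂ]
  intro B
  obtain ⟨f, hf, rfl⟩ := exists_function_cderiv_eq B
  rw [map_sub, h f hf, sub_self]

/-- Both fields act on a momentum `p_W` through the functions `F_j = p_{D_{e_j} W} + A(e_j, W)`. As
`hcov` makes `D_{e_j} W` a section of `F`, their action on `F_j` is known too, and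
`cderiv_lieBracket_of_sum` expands the bracket. -/
theorem inLift_lieBracket
    (hE : IsSubbundle I E) (hF : IsSubbundle I F)
    (hA : ∀ Y W, IsSection I E Y → IsSection I F W →
      ∀ x, ContMDiffAt I 𝓘(ℝ, ℂ) ∞ (fun y => A y (Y y) (W y)) x)
    (hinv : IsInvolutive I E)
    (hcov : ∀ X W, IsSection I E X → IsSection I F W → IsSection I F (cov D X W))
    (hcurv : ∀ X Y W, IsSection I E X → IsSection I E Y → IsSection I F W →
      ∀ x, curvature D X Y W x = 0)
    (htors : ∀ X Y W, IsSection I E X → IsSection I E Y → IsSection I F W → ∀ x,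
      covForm D A X Y W x - covForm D A Y X W x + A x (torsion D X Y x) (W x) = 0)
    {Z Z' : Π γ : CotangentBundle I M, ComplexTangentSpace (cotModel I) γ}
    (hZ : ∀ γ, CSmoothAt Z γ) (hZ' : ∀ γ, CSmoothAt Z' γ)
    (hZL : ∀ γ, InLift D E F A γ (Z γ)) (hZL' : ∀ γ, InLift D E F A γ (Z' γ))
    (γ : CotangentBundle I M) : InLift D E F A γ (lieBracket (cotModel I) Z Z' γ) := by
  obtain ⟨r, e, he, hspan⟩ := hE.exists_frame γ.proj
  obtain ⟨c, hc, hcZ⟩ := exists_coefficients hZ (fun γ => (hZL γ).1) γ he hspan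
  obtain ⟨c', hc', hcZ'⟩ := exists_coefficients hZ' (fun γ => (hZL' γ).1) γ he hspan
  -- The Leibniz expansion of the bracket of `Σ c_j e_j` and `Σ c'_j e_j`, except that the
  -- coefficients live on `T*M` and are differentiated along `Z` and `Z'`.
  set C : ComplexTangentSpace I γ.proj :=
    ∑ j, (cderiv (cotModel I) (c' j) γ (Z γ) - cderiv (cotModel I) (c j) γ (Z' γ)) • e j γ.proj
      + ∑ i, ∑ j, (c i γ * c' j γ) • lieBracket I (e i) (e j) γ.proj with hC
  have hCE : C ∈ E γ.proj := by
    refine add_mem (sum_mem fun j _ => Submodule.smul_mem _ _ ((he j).mem _))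
      (sum_mem fun i _ => sum_mem fun j _ => Submodule.smul_mem _ _ ?_)
    exact hinv _ _ (he i) (he j) _
  have hproj : projC γ (lieBracket (cotModel I) Z Z' γ) = C := by
    refine eq_of_cderiv_eq fun f hf => ?_
    have hd := fun y => (hf y).mdifferentiableAt (by simp : (∞ : WithTop ℕ∞) ≠ 0)
    rw [← cderiv_comp_proj (hd _)]
    have hFs : ∀ j y, ContMDiffAt I 𝓘(ℝ, ℂ) ∞ (fieldDeriv (e j) f) y :=
      fun j y => ((he j).csmoothAt y).fieldDeriv (hf y)
    rw [cderiv_lieBracket_of_sum (c := c) (c' := c')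
      (F := fun j γ => fieldDeriv (e j) f γ.proj)
      (G := fun i j => cderiv I (fieldDeriv (e j) f) γ.proj (e i γ.proj))
      (hZ γ) (hZ' γ) (contMDiffAt_comp_proj (hf _)) hc hc'
      (fun j => contMDiffAt_comp_proj (hFs j _))]
    · simp only [hC, map_add, map_sum, map_smul, smul_eq_mul, fieldDeriv_eq]
      congr 1
      refine Finset.sum_congr rfl fun i _ => Finset.sum_congr rfl fun j _ => ?_
      rw [cderiv_lieBracket ((he i).csmoothAt _) ((he j).csmoothAt _) (hf _)]
    · filter_upwards [hcZ] with q hq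
      rw [cderiv_comp_proj (hd _), hq]
      simp [fieldDeriv_eq]
    · filter_upwards [hcZ'] with q hq
      rw [cderiv_comp_proj (hd _), hq]
      simp [fieldDeriv_eq]
    · intro j
      rw [cderiv_comp_proj ((hFs j _).mdifferentiableAt (by simp)), hcZ.self_of_nhds]
      simp
    · intro j
      rw [cderiv_comp_proj ((hFs j _).mdifferentiableAt (by simp)), hcZ'.self_of_nhds]
      simp
  refine inLift_of_cderiv_momentum hF (by rw [hproj]; exact hCE) fun W hW => ?_
  rw [hproj]
  have hDW := fun j => hcov (e j) W (he j) hW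
  have hAs := fun j => hA (e j) W (he j) hW
  -- The membership condition of `z` is applied to the section `D_{e_j} W` of `F`.
  have hFd : ∀ j (γ : CotangentBundle I M) (z : ComplexTangentSpace (cotModel I) γ),
      InLift D E F A γ z →
      cderiv (cotModel I) (fun γ : CotangentBundle I M => momentum (cov D (e j) W) γ
        + A γ.proj (e j γ.proj) (W γ.proj)) γ z =
      evalC γ.2 (covAt D (cov D (e j) W) γ.proj (projC γ z))
        + A γ.proj (projC γ z) (cov D (e j) W γ.proj)
        + cderiv I (fun y => A y (e j y) (W y)) γ.proj (projC γ z) := by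
    intro j γ z hz
    have h1 := contMDiffAt_momentum ((hDW j).csmoothAt γ.proj)
    have h2 := contMDiffAt_comp_proj (hAs j γ.proj)
    rw [cderiv_add (h1.mdifferentiableAt (by simp)) (h2.mdifferentiableAt (by simp)),
      LinearMap.add_apply, hz.cderiv_momentum (hDW j),
      cderiv_comp_proj ((hAs j γ.proj).mdifferentiableAt (by simp))]
  rw [cderiv_lieBracket_of_sum (c := c) (c' := c')
    (F := fun j γ => momentum (cov D (e j) W) γ + A γ.proj (e j γ.proj) (W γ.proj))
    (G := fun i j => evalC γ.2 (cov D (e i) (cov D (e j) W) γ.proj)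
      + A γ.proj (e i γ.proj) (cov D (e j) W γ.proj)
      + cderiv I (fun y => A y (e j y) (W y)) γ.proj (e i γ.proj))
    (hZ γ) (hZ' γ) (contMDiffAt_momentum (hW.csmoothAt _)) hc hc'
    (fun j => (contMDiffAt_momentum ((hDW j).csmoothAt _)).add (contMDiffAt_comp_proj (hAs j _)))]
  · simp only [hC, map_add, map_sum, map_smul, smul_eq_mul, LinearMap.add_apply,
      LinearMap.sum_apply, LinearMap.smul_apply, momentum, cov_eq]
    rw [add_add_add_comm]
    refine congrArg₂ (· + ·) ?_ ?_
    · rw [← Finset.sum_add_distrib]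
      exact Finset.sum_congr rfl fun j _ => by ring
    · rw [← Finset.sum_add_distrib]
      refine Finset.sum_congr rfl fun i _ => ?_
      rw [← Finset.sum_add_distrib]
      refine Finset.sum_congr rfl fun j _ => ?_
      -- The curvature equation matches the terms linear in the covector, the torsion equation those
      -- depending only on the base point.
      have h1 := congrArg (evalC γ.2) (hcurv _ _ W (he i) (he j) hW γ.proj)
      have h2 := htors _ _ W (he i) (he j) hW γ.proj
      rw [covForm_identity] at h2
      simp only [curvature, map_add, map_neg, map_zero, cov_eq] at h1 h2
      linear_combination (c i γ * c' j γ) * (h2 - h1)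
  · filter_upwards [hcZ] with q hq
    rw [(hZL q).cderiv_momentum hW, hq]
    simp [momentum, cov_eq, Finset.sum_add_distrib, mul_add]
  · filter_upwards [hcZ'] with q hq
    rw [(hZL' q).cderiv_momentum hW, hq]
    simp [momentum, cov_eq, Finset.sum_add_distrib, mul_add]
  · intro j
    rw [hFd j γ _ (hZL γ), hcZ.self_of_nhds]
    simp [cov_eq, Finset.sum_add_distrib, mul_add]
  · intro j
    rw [hFd j γ _ (hZL' γ), hcZ'.self_of_nhds]
    simp [cov_eq, Finset.sum_add_distrib, mul_add]

end Core

/-! ### A smoothness criterion for vector fields -/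

section FieldCriterion

open scoped Topology

variable {V : Type*} [NormedAddCommGroup V] [NormedSpace ℝ V] [FiniteDimensional ℝ V]
  {H : Type*} [TopologicalSpace H] {I : ModelWithCorners ℝ V H}
  {N : Type*} [TopologicalSpace N] [ChartedSpace H N] [IsManifold I ∞ N]

-- The trivialization of the tangent bundle at `p` is the differential of the chart at `p`.
omit [FiniteDimensional ℝ V] in
theorem contMDiffAt_field_iff {P : Π x : N, TangentSpace I x} {p : N} :
    ContMDiffAt I I.tangent ∞ (fun y => (⟨y, P y⟩ : TangentBundle I N)) p ↔
      ContMDiffAt I 𝓘(ℝ, V) ∞ (fun y => (mvfderiv I (extChartAt I p) y (P y) : V)) p := by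
  have : IsManifold I 1 N := IsManifold.of_le (n := ∞) (by simp)
  rw [contMDiffAt_section]
  refine Filter.EventuallyEq.contMDiffAt_iff ?_
  filter_upwards [(chartAt H p).open_source.mem_nhds (mem_chart_source H p)] with y hy
  have h := TangentBundle.continuousLinearMapAt_trivializationAt (I := I) (x₀ := p) (x := y) hy
  have h2 := congrArg (fun L : TangentSpace I y →L[ℝ] V => L (P y)) h
  refine Eq.trans ?_ h2
  exact (Trivialization.continuousLinearMapAt_apply_of_mem (R := ℝ) _ hy _).symm

variable [I.Boundaryless] {K : Type*} [NormedAddCommGroup K] [NormedSpace ℝ K]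
  [FiniteDimensional ℝ K]

/-- A vector field is smooth at a point if its derivative of an immersion is. -/
theorem contMDiffAt_of_mvfderiv_apply {P : Π x : N, TangentSpace I x} {p : N} {f : N → K}
    (hf : ContMDiffAt I 𝓘(ℝ, K) ∞ f p)
    (hinj : ∀ v : TangentSpace I p, mvfderiv I f p v = 0 → v = 0)
    (h : ContMDiffAt I 𝓘(ℝ, K) ∞ (fun y => (mvfderiv I f y (P y) : K)) p) :
    ContMDiffAt I I.tangent ∞ (fun y => (⟨y, P y⟩ : TangentBundle I N)) p := by
  have : IsManifold I 1 N := IsManifold.of_le (n := ∞) (by simp)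
  rw [contMDiffAt_field_iff]
  set g := f ∘ (extChartAt I p).symm with hg
  have hgs : ContDiffAt ℝ ∞ (fderiv ℝ g) (extChartAt I p p) :=
    (contDiffAt_chart_expr hf).fderiv_right (m := ∞) (by simp)
  have hev := eventually_mvfderiv_eq (hf.of_le (by simp : (1 : WithTop ℕ∞) ≤ ∞))
  obtain ⟨e, he⟩ := isInvertible_mfderiv_extChartAt (I := I) (mem_extChartAt_source (I := I) p)
  have hker : LinearMap.ker (fderiv ℝ g (extChartAt I p p)).toLinearMap = ⊥ := by
    rw [LinearMap.ker_eq_bot']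
    intro v hv
    have h1 := hev.self_of_nhds (e.symm v)
    have h2 : mvfderiv I (extChartAt I p) p (e.symm v) = v := by
      have : mfderiv I 𝓘(ℝ, V) (extChartAt I p) p (e.symm v) = v := by
        rw [← he]
        exact e.apply_symm_apply v
      exact this
    rw [h2] at h1
    have h3 := hinj _ (h1.trans hv)
    exact e.symm.injective (h3.trans e.symm.map_zero.symm)
  -- With `L` a left inverse of the differential at `p`, the map `L ∘ dg` is the identity at `p` and
  -- so invertible nearby. There the coordinates of `P` are recovered as `(L ∘ dg)⁻¹ (L (P f))`, and
  -- inversion is smooth.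
  obtain ⟨L₀, hL₀⟩ := LinearMap.exists_leftInverse_of_injective _ hker
  set L : K →L[ℝ] V := LinearMap.toContinuousLinearMap L₀
  have hL : L ∘L fderiv ℝ g (extChartAt I p p) = ContinuousLinearMap.id ℝ V :=
    ContinuousLinearMap.ext fun v => LinearMap.congr_fun hL₀ v
  have hφ : ContMDiffAt I 𝓘(ℝ, V) ∞ (extChartAt I p) p := contMDiffAt_extChartAt
  have ha : ContMDiffAt I 𝓘(ℝ, V →L[ℝ] V) ∞
      (fun y => L ∘L fderiv ℝ g (extChartAt I p y)) p :=
    ((contDiffAt_const (c := L)).clm_comp hgs).contMDiffAt.comp p hφ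
  have hinv : ContMDiffAt I 𝓘(ℝ, V →L[ℝ] V) ∞
      (fun y => ContinuousLinearMap.inverse (L ∘L fderiv ℝ g (extChartAt I p y))) p := by
    refine ContMDiffAt.comp (g := ContinuousLinearMap.inverse) (I' := 𝓘(ℝ, V →L[ℝ] V)) p ?_ ha
    rw [hL]
    exact (contDiffAt_map_inverse (ContinuousLinearEquiv.refl ℝ V)).contMDiffAt
  have hopen : ∀ᶠ y in 𝓝 p, (L ∘L fderiv ℝ g (extChartAt I p y)).IsInvertible := by
    have h1 := ContinuousLinearEquiv.nhds (ContinuousLinearEquiv.refl ℝ V)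
    exact ha.continuousAt.eventually (p := fun A : V →L[ℝ] V => A.IsInvertible)
      (by simp only [hL]; exact h1)
  have hres : ContMDiffAt I 𝓘(ℝ, V) ∞ (fun y =>
      ContinuousLinearMap.inverse (L ∘L fderiv ℝ g (extChartAt I p y))
        (L (mvfderiv I f y (P y)))) p :=
    hinv.clm_apply (L.contDiff.contMDiff.contMDiffAt.comp p h)
  refine hres.congr_of_eventuallyEq ?_
  filter_upwards [hev, hopen] with y hy hi
  rw [hy]
  obtain ⟨e', he'⟩ := hi
  rw [← he', ContinuousLinearMap.inverse_equiv]
  refine ((e'.symm_apply_eq).2 ?_).symm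
  exact (DFunLike.congr_fun he' _).symm

end FieldCriterion

/-! ### Smoothness of the splitting -/

section LiftSmooth

open scoped Topology

variable {V : Type*} [NormedAddCommGroup V] [NormedSpace ℝ V] [FiniteDimensional ℝ V]
  {H : Type*} [TopologicalSpace H] {I : ModelWithCorners ℝ V H}
  {M : Type*} [TopologicalSpace M] [ChartedSpace H M] [IsManifold I ∞ M]

omit [FiniteDimensional ℝ V] [IsManifold I ∞ M] in
theorem mvfderiv_clm_comp {K K' : Type*} [NormedAddCommGroup K] [NormedSpace ℝ K]
    [NormedAddCommGroup K'] [NormedSpace ℝ K'] (L : K →L[ℝ] K') {f : M → K} {x : M}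
    (hf : MDifferentiableAt I 𝓘(ℝ, K) f x) (v : TangentSpace I x) :
    mvfderiv I (fun y => L (f y)) x v = L (mvfderiv I f x v) := by
  have h := mfderiv_comp_apply (I := I) (I' := 𝓘(ℝ, K)) (I'' := 𝓘(ℝ, K')) x
    (g := L) (f := f) L.mdifferentiableAt hf v
  rw [ContinuousLinearMap.mfderiv_eq] at h
  exact h

theorem exists_real_field_eq [T2Space M] {x₀ : M} (v : TangentSpace I x₀) :
    ∃ W : Π x : M, TangentSpace I x,
      ContMDiff I I.tangent ∞ (fun x => (⟨x, W x⟩ : TangentBundle I M)) ∧ W x₀ = v := by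
  have : IsManifold I 1 M := IsManifold.of_le (n := ∞) (by simp)
  obtain ⟨s, hs, hv⟩ := exists_contMDiffOn_extend (k := ∞) I V v
  obtain ⟨χ, hχ, hχ1, hχ0⟩ := exists_cutoff I (interior_mem_nhds.2 hs)
  -- The real field is treated as a complex one with zero imaginary part, so that the complex cutoff
  -- applies.
  have h := smoothOn_cutoff_smul (Z := fun x => cmk (extend V v x) 0) hχ hχ0 fun x hx => by
    refine ⟨?_, ?_⟩
    · simp only [cre_cmk]
      exact hv.contMDiffAt (mem_interior_iff_mem_nhds.1 hx)
    · simp only [cim_cmk]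
      exact contMDiff_zeroSection ℝ _ _
  refine ⟨_, contMDiffOn_univ.1 h.1, ?_⟩
  change cre (χ x₀ • cmk (extend V v x₀) 0) = v
  rw [hχ1.self_of_nhds, one_smul, cre_cmk, extend_apply_self]

variable [T2Space M] [I.Boundaryless]
  {D : CovariantDerivative I V (TangentSpace I : M → Type _)}

/-- The base coordinates together with the momenta of fields `W i` forming a basis at the base point
are an immersion at `γ₀`. Its derivative along the lifted field has components `dφ(U)` and `p_{D_U
W_i} + ρ(W_i)`, which are smooth. -/
theorem contMDiffAt_splitting (hD : D.ContMDiffCovariantDerivative ∞)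
    {U : Π x : M, TangentSpace I x} {ρ : Π x : M, CotangentSpace I x} {γ₀ : CotangentBundle I M}
    (hU : ContMDiffAt I I.tangent ∞ (fun x => (⟨x, U x⟩ : TangentBundle I M)) γ₀.proj)
    (hρ : ∀ W : Π x : M, TangentSpace I x,
      ContMDiff I I.tangent ∞ (fun x => (⟨x, W x⟩ : TangentBundle I M)) →
      ContMDiffAt I 𝓘(ℝ, ℝ) ∞ (fun y => ρ y (W y)) γ₀.proj) :
    ContMDiffAt (cotModel I) (cotModel I).tangent ∞
      (fun γ => (⟨γ, splitting D γ (U γ.proj, ρ γ.proj)⟩ :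
        TangentBundle (cotModel I) (CotangentBundle I M))) γ₀ := by
  have hI : IsManifold I 1 M := IsManifold.of_le (n := ∞) (by simp)
  let b := Module.finBasis ℝ V
  choose W hW hWb using fun i => exists_real_field_eq (I := I) (x₀ := γ₀.proj) (b i)
  have hp : ∀ γ, ContMDiffAt (cotModel I) I ∞ (TotalSpace.proj : CotangentBundle I M → M) γ :=
    fun γ => (Bundle.contMDiff_proj (n := ∞) (IB := I)
      (fun x : M => CotangentSpace I x)).contMDiffAt
  have hφ : ContMDiffAt I 𝓘(ℝ, V) ∞ (extChartAt I γ₀.proj) γ₀.proj := contMDiffAt_extChartAt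
  set f : CotangentBundle I M → V × (Fin (Module.finrank ℝ V) → ℝ) :=
    fun γ => (extChartAt I γ₀.proj γ.proj, fun i => realMomentum (W i) γ) with hfdef
  have hf : ContMDiffAt (cotModel I) 𝓘(ℝ, V × (Fin (Module.finrank ℝ V) → ℝ)) ∞ f γ₀ :=
    (hφ.comp γ₀ (hp γ₀)).prodMk_space
      (contMDiffAt_pi_space.2 fun i => contMDiffAt_realMomentum (hW i).contMDiffAt)
  have hfd : ∀ᶠ γ in 𝓝 γ₀,
      MDifferentiableAt (cotModel I) 𝓘(ℝ, V × (Fin (Module.finrank ℝ V) → ℝ)) f γ := by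
    filter_upwards [(contMDiffAt_iff_contMDiffAt_nhds (by simp)).1
      (hf.of_le (by simp : (1 : WithTop ℕ∞) ≤ ∞))] with γ h
    exact h.mdifferentiableAt (by simp)
  have hφd : ∀ᶠ γ : CotangentBundle I M in 𝓝 γ₀,
      MDifferentiableAt I 𝓘(ℝ, V) (extChartAt I γ₀.proj) γ.proj := by
    have h1 : ∀ᶠ x in 𝓝 γ₀.proj, MDifferentiableAt I 𝓘(ℝ, V) (extChartAt I γ₀.proj) x := by
      filter_upwards [(contMDiffAt_iff_contMDiffAt_nhds (by simp)).1
        (hφ.of_le (by simp : (1 : WithTop ℕ∞) ≤ ∞))] with x h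
      exact h.mdifferentiableAt (by simp)
    exact ((FiberBundle.continuous_proj _ _).tendsto γ₀).eventually h1
  have hfst : ∀ᶠ γ in 𝓝 γ₀, ∀ u : GenTangentSpace I γ.proj,
      (mvfderiv (cotModel I) f γ (splitting D γ u)).1 =
        mvfderiv I (extChartAt I γ₀.proj) γ.proj u.1 := by
    filter_upwards [hfd, hφd] with γ h1 h2 u
    refine (mvfderiv_clm_comp (ContinuousLinearMap.fst ℝ V _) h1 _).symm.trans ?_
    refine (mfderiv_comp_apply (I := cotModel I) (I' := I) (I'' := 𝓘(ℝ, V)) γ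
      (g := extChartAt I γ₀.proj) (f := (TotalSpace.proj : CotangentBundle I M → M)) h2
      (mdiff_proj γ) _).trans ?_
    exact congrArg (mvfderiv I (extChartAt I γ₀.proj) γ.proj) (dproj_splitting D γ u)
  have hsnd : ∀ᶠ γ in 𝓝 γ₀, ∀ (u : GenTangentSpace I γ.proj) i,
      (mvfderiv (cotModel I) f γ (splitting D γ u)).2 i =
        γ.2 (D (W i) γ.proj u.1) + u.2 (W i γ.proj) := by
    filter_upwards [hfd] with γ h1 u i
    refine (mvfderiv_clm_comp ((ContinuousLinearMap.proj i).comp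
      (ContinuousLinearMap.snd ℝ V (Fin (Module.finrank ℝ V) → ℝ))) h1 _).symm.trans ?_
    exact mvfderiv_realMomentum_splitting D ((hW i).contMDiffAt.mdifferentiableAt (by simp)) u
  refine contMDiffAt_of_mvfderiv_apply hf ?_ ?_
  -- The base coordinates force the horizontal component to vanish; the momenta then give `u.2 (b i)
  -- = 0` on a basis.
  · intro v hv
    obtain ⟨u, rfl⟩ := (splitting D γ₀).surjective v
    have h1 : u.1 = 0 := by
      have h2 := hfst.self_of_nhds u
      rw [hv] at h2
      obtain ⟨e, he⟩ :=
        isInvertible_mfderiv_extChartAt (I := I) (mem_extChartAt_source (I := I) γ₀.proj)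
      have h3 : e u.1 = 0 := by
        refine Eq.trans ?_ h2.symm
        exact DFunLike.congr_fun he u.1
      exact e.injective (h3.trans e.map_zero.symm)
    have h2 : u.2 = 0 := by
      have h3 : ∀ i, u.2 (b i) = 0 := fun i => by
        have h4 := hsnd.self_of_nhds u i
        rw [hv, h1, hWb] at h4
        have h5 : γ₀.2 (D (W i) γ₀.proj 0) = 0 :=
          (congrArg γ₀.2 (map_zero (D (W i) γ₀.proj))).trans (map_zero γ₀.2)
        rw [h5, zero_add] at h4
        exact h4.symm
      exact ContinuousLinearMap.coe_injective (b.ext h3)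
    have h3 : u = 0 := Prod.ext h1 h2
    rw [h3, map_zero]
  · refine ContMDiffAt.congr_of_eventuallyEq (f := fun γ : CotangentBundle I M =>
      ((mvfderiv I (extChartAt I γ₀.proj) γ.proj (U γ.proj),
        fun i => realMomentum (fun x => D (W i) x (U x)) γ + ρ γ.proj (W i γ.proj)) :
        V × (Fin (Module.finrank ℝ V) → ℝ))) ?_ ?_
    · refine ((contMDiffAt_mvfderiv_apply hU hφ).comp γ₀ (hp γ₀)).prodMk_space
        (contMDiffAt_pi_space.2 fun i => ?_)
      exact (contMDiffAt_realMomentum (contMDiffAt_cov_real hD hU (hW i))).add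
        ((hρ (W i) (hW i)).comp γ₀ (hp γ₀))
    · filter_upwards [hfst, hsnd] with γ h1 h2
      exact Prod.ext (h1 _) (funext fun i => h2 _ i)

end LiftSmooth

/-! ### Lifts of generalized vector fields and their brackets -/

section Lift

open scoped Topology

variable {V : Type*} [NormedAddCommGroup V] [NormedSpace ℝ V] [FiniteDimensional ℝ V]
  {H : Type*} [TopologicalSpace H] {I : ModelWithCorners ℝ V H}
  {M : Type*} [TopologicalSpace M] [ChartedSpace H M]

/-- The continuous covector with the values of a given linear functional. -/
def toCovector {x : M} (f : TangentSpace I x →ₗ[ℝ] ℝ) : CotangentSpace I x :=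
  (show V →L[ℝ] ℝ from LinearMap.toContinuousLinearMap (𝕜 := ℝ) (E := V) (F' := ℝ) f)

/-- The complex covector defined by a complex linear functional. -/
def covectorOf {x : M} (B : ComplexTangentSpace I x →ₗ[ℂ] ℂ) : ℂ ⊗[ℝ] CotangentSpace I x :=
  cmk (toCovector (Complex.reLm ∘ₗ restrictReal B)) (toCovector (Complex.imLm ∘ₗ restrictReal B))

theorem cre_covectorOf_apply {x : M} (B : ComplexTangentSpace I x →ₗ[ℂ] ℂ)
    (v : TangentSpace I x) : cre (covectorOf B) v = (B (1 ⊗ₜ v)).re := by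
  rw [covectorOf, cre_cmk]
  rfl

theorem cim_covectorOf_apply {x : M} (B : ComplexTangentSpace I x →ₗ[ℂ] ℂ)
    (v : TangentSpace I x) : cim (covectorOf B) v = (B (1 ⊗ₜ v)).im := by
  rw [covectorOf, cim_cmk]
  rfl

theorem pairing_covectorOf {x : M} (B : ComplexTangentSpace I x →ₗ[ℂ] ℂ)
    (z : ComplexTangentSpace I x) : pairing (covectorOf B) z = B z := by
  have h : B z = B (1 ⊗ₜ cre z) + Complex.I * B (1 ⊗ₜ cim z) := by
    conv_lhs => rw [← cmk_cre_cim z]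
    rw [cmk, map_add, ← smul_eq_mul, ← map_smul, TensorProduct.smul_tmul', smul_eq_mul, mul_one]
  rw [pairing_eq, evalC_apply, evalC_apply, h]
  simp only [cre_covectorOf_apply, cim_covectorOf_apply]
  conv_rhs => rw [← Complex.re_add_im (B (1 ⊗ₜ cre z)), ← Complex.re_add_im (B (1 ⊗ₜ cim z))]
  ring

variable [IsManifold I ∞ M]

/-- A field of complex linear functionals is smooth if its values on smooth fields are. -/
def IsSmoothFunctional (ξ : Π x : M, ComplexTangentSpace I x →ₗ[ℂ] ℂ) : Prop :=
  ∀ W : Π x : M, ComplexTangentSpace I x, SmoothOn I W Set.univ →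
    ∀ x, ContMDiffAt I 𝓘(ℝ, ℂ) ∞ (fun y => ξ y (W y)) x

variable (D : CovariantDerivative I V (TangentSpace I : M → Type _))

/-- The lift to the cotangent manifold, by means of `D`, of a complex section `X + ξ` of the
generalized tangent bundle. -/
def lift (X : Π x : M, ComplexTangentSpace I x) (ξ : Π x : M, ComplexTangentSpace I x →ₗ[ℂ] ℂ)
    (γ : CotangentBundle I M) : ComplexTangentSpace (cotModel I) γ :=
  cmk (splitting D γ (cre (X γ.proj), cre (covectorOf (ξ γ.proj))))
    (splitting D γ (cim (X γ.proj), cim (covectorOf (ξ γ.proj))))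

theorem projC_lift (X : Π x : M, ComplexTangentSpace I x)
    (ξ : Π x : M, ComplexTangentSpace I x →ₗ[ℂ] ℂ) (γ : CotangentBundle I M) :
    projC γ (lift D X ξ γ) = X γ.proj := by
  refine ext_cre_cim ?_ ?_
  · rw [projC, cre_baseChange, lift, cre_cmk]
    exact dproj_splitting D γ _
  · rw [projC, cim_baseChange, lift, cim_cmk]
    exact dproj_splitting D γ _

theorem pairing_vertC_lift (X : Π x : M, ComplexTangentSpace I x)
    (ξ : Π x : M, ComplexTangentSpace I x →ₗ[ℂ] ℂ) (γ : CotangentBundle I M)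
    (w : ComplexTangentSpace I γ.proj) :
    pairing (vertC D γ (lift D X ξ γ)) w = ξ γ.proj w := by
  have h : vertC D γ (lift D X ξ γ) = covectorOf (ξ γ.proj) := by
    refine ext_cre_cim ?_ ?_
    · rw [vertC, cre_baseChange, lift, cre_cmk]
      exact congrArg Prod.snd ((splitting D γ).symm_apply_apply _)
    · rw [vertC, cim_baseChange, lift, cim_cmk]
      exact congrArg Prod.snd ((splitting D γ).symm_apply_apply _)
  rw [h, pairing_covectorOf]

theorem cderiv_momentum_lift (X : Π x : M, ComplexTangentSpace I x)
    (ξ : Π x : M, ComplexTangentSpace I x →ₗ[ℂ] ℂ) (γ : CotangentBundle I M)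
    {W : Π x : M, ComplexTangentSpace I x} (hW : CSmoothAt W γ.proj) :
    cderiv (cotModel I) (momentum W) γ (lift D X ξ γ) =
      momentum (cov D X W) γ + ξ γ.proj (W γ.proj) := by
  rw [cderiv_momentum D hW, projC_lift, pairing_vertC_lift, momentum, cov_eq]

variable {D} [T2Space M] [I.Boundaryless]

theorem csmoothAt_lift (hD : D.ContMDiffCovariantDerivative ∞)
    {X : Π x : M, ComplexTangentSpace I x} {ξ : Π x : M, ComplexTangentSpace I x →ₗ[ℂ] ℂ}
    (hX : ∀ x, CSmoothAt X x) (hξ : IsSmoothFunctional ξ) (γ : CotangentBundle I M) :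
    CSmoothAt (lift D X ξ) γ := by
  have hW' : ∀ W : Π x : M, TangentSpace I x,
      ContMDiff I I.tangent ∞ (fun x => (⟨x, W x⟩ : TangentBundle I M)) →
      ∀ x, ContMDiffAt I 𝓘(ℝ, ℂ) ∞ (fun y => ξ y (1 ⊗ₜ W y)) x := by
    intro W hW
    refine hξ (fun x => 1 ⊗ₜ W x) ⟨?_, ?_⟩
    · simpa using hW.contMDiffOn
    · simp only [cim_tmul, Complex.one_im, zero_smul]
      exact (contMDiff_zeroSection ℝ _).contMDiffOn
  refine ⟨?_, ?_⟩
  · simp only [lift, cre_cmk]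
    refine contMDiffAt_splitting (U := fun x => cre (X x))
      (ρ := fun x => cre (covectorOf (ξ x))) hD (hX _).1 fun W hW => ?_
    simp only [cre_covectorOf_apply]
    exact Complex.reCLM.contDiff.contMDiff.contMDiffAt.comp _ (hW' W hW _)
  · simp only [lift, cim_cmk]
    refine contMDiffAt_splitting (U := fun x => cim (X x))
      (ρ := fun x => cim (covectorOf (ξ x))) hD (hX _).2 fun W hW => ?_
    simp only [cim_covectorOf_apply]
    exact Complex.imCLM.contDiff.contMDiff.contMDiffAt.comp _ (hW' W hW _)

/-- A lift is related to its base field by the projection, and brackets of related fields are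
related. -/
theorem projC_lieBracket_lift (hD : D.ContMDiffCovariantDerivative ∞)
    {X Y : Π x : M, ComplexTangentSpace I x} {ξ η : Π x : M, ComplexTangentSpace I x →ₗ[ℂ] ℂ}
    (hX : ∀ x, CSmoothAt X x) (hξ : IsSmoothFunctional ξ)
    (hY : ∀ x, CSmoothAt Y x) (hη : IsSmoothFunctional η) (γ : CotangentBundle I M) :
    projC γ (lieBracket (cotModel I) (lift D X ξ) (lift D Y η) γ) = lieBracket I X Y γ.proj := by
  refine eq_of_cderiv_eq fun f hf => ?_
  have key : ∀ {X : Π x : M, ComplexTangentSpace I x}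
      {ξ : Π x : M, ComplexTangentSpace I x →ₗ[ℂ] ℂ} {g : M → ℂ},
      (∀ x, ContMDiffAt I 𝓘(ℝ, ℂ) ∞ g x) →
      fieldDeriv (lift D X ξ) (fun γ : CotangentBundle I M => g γ.proj) =
        fun γ : CotangentBundle I M => fieldDeriv X g γ.proj := by
    intro X ξ g hg
    funext γ
    rw [fieldDeriv_eq, cderiv_comp_proj ((hg _).mdifferentiableAt (by simp)), projC_lift,
      fieldDeriv_eq]
  have hd : ∀ {X : Π x : M, ComplexTangentSpace I x}, (∀ x, CSmoothAt X x) →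
      ∀ x, ContMDiffAt I 𝓘(ℝ, ℂ) ∞ (fieldDeriv X f) x := fun hX x => (hX x).fieldDeriv (hf x)
  rw [← cderiv_comp_proj ((hf _).mdifferentiableAt (by simp)),
    cderiv_lieBracket (csmoothAt_lift hD hX hξ γ) (csmoothAt_lift hD hY hη γ)
      (contMDiffAt_comp_proj (hf _)), key hf, key hf,
    cderiv_lieBracket (hX _) (hY _) (hf _),
    cderiv_comp_proj ((hd hX _).mdifferentiableAt (by simp)),
    cderiv_comp_proj ((hd hY _).mdifferentiableAt (by simp)), projC_lift, projC_lift]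

/-- A lift sends `p_W` to `p_{D_X W} + ξ(W)`, a momentum plus a pullback, so the second derivation
is again explicit. Here `W` is any smooth field: for necessity it is not yet known that `D_X W`
stays in `F`. -/
theorem cderiv_momentum_lieBracket_lift (hD : D.ContMDiffCovariantDerivative ∞)
    {X Y : Π x : M, ComplexTangentSpace I x} {ξ η : Π x : M, ComplexTangentSpace I x →ₗ[ℂ] ℂ}
    (hX : ∀ x, CSmoothAt X x) (hξ : IsSmoothFunctional ξ)
    (hY : ∀ x, CSmoothAt Y x) (hη : IsSmoothFunctional η)
    {W : Π x : M, ComplexTangentSpace I x} (hW : SmoothOn I W Set.univ)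
    (γ : CotangentBundle I M) :
    cderiv (cotModel I) (momentum W) γ
        (lieBracket (cotModel I) (lift D X ξ) (lift D Y η) γ) =
      evalC γ.2 (cov D X (cov D Y W) γ.proj - cov D Y (cov D X W) γ.proj)
        + (ξ γ.proj (cov D Y W γ.proj) - η γ.proj (cov D X W γ.proj)
          + cderiv I (fun y => η y (W y)) γ.proj (X γ.proj)
          - cderiv I (fun y => ξ y (W y)) γ.proj (Y γ.proj)) := by
  have hWs := smoothOn_univ_iff.1 hW
  have key : ∀ {X Y : Π x : M, ComplexTangentSpace I x}
      {ξ η : Π x : M, ComplexTangentSpace I x →ₗ[ℂ] ℂ}, (∀ x, CSmoothAt Y x) →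
      IsSmoothFunctional η →
      cderiv (cotModel I) (fieldDeriv (lift D Y η) (momentum W)) γ (lift D X ξ γ) =
        momentum (cov D X (cov D Y W)) γ + ξ γ.proj (cov D Y W γ.proj)
          + cderiv I (fun y => η y (W y)) γ.proj (X γ.proj) := by
    intro X Y ξ η hY hη
    have h1 : fieldDeriv (lift D Y η) (momentum W) =
        fun γ => momentum (cov D Y W) γ + η γ.proj (W γ.proj) :=
      funext fun γ => by rw [fieldDeriv_eq, cderiv_momentum_lift D _ _ _ (hWs _)]
    have h2 : CSmoothAt (cov D Y W) γ.proj := (hY _).cov hD hW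
    have h3 := contMDiffAt_comp_proj (hη W hW γ.proj)
    rw [h1, cderiv_add ((contMDiffAt_momentum h2).mdifferentiableAt (by simp))
      (h3.mdifferentiableAt (by simp)), LinearMap.add_apply, cderiv_momentum_lift D _ _ _ h2,
      cderiv_comp_proj ((hη W hW _).mdifferentiableAt (by simp)), projC_lift]
  rw [cderiv_lieBracket (csmoothAt_lift hD hX hξ γ) (csmoothAt_lift hD hY hη γ)
      (contMDiffAt_momentum (hWs _)), key hY hη, key hX hξ, momentum, momentum, map_sub]
  ring

end Lift

/-! ### Sections of the generalized bundle with prescribed covector at a point -/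

section Adapted

open scoped Topology

variable {V : Type*} [NormedAddCommGroup V] [NormedSpace ℝ V] [FiniteDimensional ℝ V]
  {H : Type*} [TopologicalSpace H] {I : ModelWithCorners ℝ V H}
  {M : Type*} [TopologicalSpace M] [ChartedSpace H M] [IsManifold I ∞ M] [T2Space M]
  [I.Boundaryless] {E F : Π x : M, Submodule ℂ (ComplexTangentSpace I x)}
  {A : Π x : M, ComplexTangentSpace I x →ₗ[ℂ] ComplexTangentSpace I x →ₗ[ℂ] ℂ}

/-- Near `x₀` one seeks `ξ = dh₀ + Σ c_k dh_k`, where `dh₀ = B` at `x₀` and the `h k` are dual to a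
frame of `F`. The constraint on `F` is then a linear system for the `c_k`. -/
theorem exists_adapted_functional (hF : IsSubbundle I F)
    (hA : ∀ Y W, IsSection I E Y → IsSection I F W →
      ∀ x, ContMDiffAt I 𝓘(ℝ, ℂ) ∞ (fun y => A y (Y y) (W y)) x)
    {X : Π x : M, ComplexTangentSpace I x} (hX : IsSection I E X) {x₀ : M}
    {B : ComplexTangentSpace I x₀ →ₗ[ℂ] ℂ} (hB : ∀ w ∈ F x₀, B w = A x₀ (X x₀) w) :
    ∃ (X' : Π x : M, ComplexTangentSpace I x) (ξ : Π x : M, ComplexTangentSpace I x →ₗ[ℂ] ℂ),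
      IsSection I E X' ∧ (∀ᶠ x in 𝓝 x₀, X' x = X x) ∧ IsSmoothFunctional ξ ∧ ξ x₀ = B ∧
      ∀ x, ∀ w ∈ F x, ξ x w = A x (X' x) w := by
  obtain ⟨r, e, he, hspan⟩ := hF.exists_frame x₀
  obtain ⟨h, hh, hdual⟩ := exists_dual_functions hspan.self_of_nhds.1
  obtain ⟨h₀, hh₀, hB₀⟩ := exists_function_cderiv_eq B
  have hm : ∀ j k x, ContMDiffAt I 𝓘(ℝ, ℂ) ∞ (fieldDeriv (e j) (h k)) x :=
    fun j k x => ((he j).csmoothAt x).fieldDeriv (hh k x)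
  have hb : ∀ j x, ContMDiffAt I 𝓘(ℝ, ℂ) ∞
      (fun x => A x (X x) (e j x) - fieldDeriv (e j) h₀ x) x :=
    fun j x => (hA X (e j) hX (he j) x).sub (((he j).csmoothAt x).fieldDeriv (hh₀ x))
  obtain ⟨c, hc⟩ := exists_smooth_solution (p := x₀) hm hb fun j k => by
    rw [fieldDeriv_eq, hdual]
    simp only [eq_comm]
  obtain ⟨U, hU, hUx⟩ := (hspan.and hc).exists_mem
  obtain ⟨χ, hχ, hχ1, hχ0⟩ := exists_cutoff I hU
  -- The same cutoff multiplies `X` and `ξ`, since the constraint is linear in the pair.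
  refine ⟨fun x => χ x • X x, fun x => χ x • (cderiv I h₀ x + ∑ k, c k x • cderiv I (h k) x),
    hX.smul hχ, ?_, ?_, ?_, ?_⟩
  · filter_upwards [hχ1] with x hx
    rw [hx, one_smul]
  · intro W hW x
    have hWs := smoothOn_univ_iff.1 hW
    by_cases hx : x ∈ U
    · have h1 : ContMDiffAt I 𝓘(ℝ, ℂ) ∞
          (fun y => χ y * (fieldDeriv W h₀ y + ∑ k, c k y * fieldDeriv W (h k) y)) x :=
        (hχ x).cmul (((hWs x).fieldDeriv (hh₀ x)).add
          (contMDiffAt_sum _ fun k _ => ((hUx x hx).2.1 k).cmul ((hWs x).fieldDeriv (hh k x))))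
      refine h1.congr_of_eventuallyEq (Filter.Eventually.of_forall fun y => ?_)
      simp [fieldDeriv_eq, mul_add]
    · refine (contMDiffAt_const (c := (0 : ℂ))).congr_of_eventuallyEq ?_
      filter_upwards [hχ0 x hx] with y hy
      rw [hy, zero_smul, LinearMap.zero_apply]
  -- At `x₀` the right-hand side of the system vanishes by `hB`, so all `c k x₀` are zero and the
  -- value there is `B`.
  · have h1 := (hc.self_of_nhds.2 (fun _ => 0)).1 fun k => by
      simp [fieldDeriv_eq, hB₀, hB _ ((he k).mem x₀)]
    simp [← h1, hχ1.self_of_nhds, hB₀]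
  · intro x w hw
    by_cases hx : x ∈ U
    · rw [← (hUx x hx).1.2, Submodule.mem_span_range_iff_exists_fun] at hw
      obtain ⟨a, rfl⟩ := hw
      have h1 := ((hUx x hx).2.2 fun j => c j x).2 fun _ => rfl
      simp only [map_sum, map_smul]
      refine Finset.sum_congr rfl fun j _ => congrArg (a j • ·) ?_
      have h2 := h1 j
      simp only [fieldDeriv_eq] at h2
      simp only [LinearMap.smul_apply, LinearMap.add_apply, LinearMap.sum_apply, smul_eq_mul]
      have h3 : ∑ k, c k x * cderiv I (h k) x (e j x) = ∑ k, cderiv I (h k) x (e j x) * c k x :=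
        Finset.sum_congr rfl fun k _ => mul_comm _ _
      rw [h3, h2]
      ring
    · simp [(hχ0 x hx).self_of_nhds]

end Adapted

/-! ### Necessity: involutivity of the lift implies the structure equations -/

section Necessity

open scoped Topology

variable {V : Type*} [NormedAddCommGroup V] [NormedSpace ℝ V] [FiniteDimensional ℝ V]
  {H : Type*} [TopologicalSpace H] {I : ModelWithCorners ℝ V H}
  {M : Type*} [TopologicalSpace M] [ChartedSpace H M] [IsManifold I ∞ M] [T2Space M]
  [I.Boundaryless]
  {D : CovariantDerivative I V (TangentSpace I : M → Type _)}
  {E F : Π x : M, Submodule ℂ (ComplexTangentSpace I x)}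
  {A : Π x : M, ComplexTangentSpace I x →ₗ[ℂ] ComplexTangentSpace I x →ₗ[ℂ] ℂ}

omit [FiniteDimensional ℝ V] [T2Space M] [I.Boundaryless] in
theorem covAt_congr {W W' : Π x : M, ComplexTangentSpace I x} {x : M} (hW : CSmoothAt W x)
    (hW' : CSmoothAt W' x) (h : ∀ᶠ y in 𝓝 x, W y = W' y) : covAt D W x = covAt D W' x := by
  have hr := D.isCovariantDerivativeOn.congr_of_eventuallyEq
    (hW.1.mdifferentiableAt (by simp)) (hW'.1.mdifferentiableAt (by simp)) Filter.univ_mem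
    (h.mono fun y hy => congrArg cre hy)
  have hi := D.isCovariantDerivativeOn.congr_of_eventuallyEq
    (hW.2.mdifferentiableAt (by simp)) (hW'.2.mdifferentiableAt (by simp)) Filter.univ_mem
    (h.mono fun y hy => congrArg cim hy)
  rw [covAt, covAt, hr, hi]

/-- The pointwise content of the involutivity of the lifted distribution. -/
theorem structure_equations_of_involutive (hD : D.ContMDiffCovariantDerivative ∞)
    (hF : IsSubbundle I F)
    (hA : ∀ Y W, IsSection I E Y → IsSection I F W →
      ∀ x, ContMDiffAt I 𝓘(ℝ, ℂ) ∞ (fun y => A y (Y y) (W y)) x)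
    (hinvol : ∀ Z Z' : Π γ : CotangentBundle I M, ComplexTangentSpace (cotModel I) γ,
      (∀ γ, CSmoothAt Z γ) → (∀ γ, CSmoothAt Z' γ) →
      (∀ γ, InLift D E F A γ (Z γ)) → (∀ γ, InLift D E F A γ (Z' γ)) →
      ∀ γ, InLift D E F A γ (lieBracket (cotModel I) Z Z' γ))
    {X Y : Π x : M, ComplexTangentSpace I x} (hX : IsSection I E X) (hY : IsSection I E Y)
    {x₀ : M} {B C : ComplexTangentSpace I x₀ →ₗ[ℂ] ℂ}
    (hB : ∀ w ∈ F x₀, B w = A x₀ (X x₀) w) (hC : ∀ w ∈ F x₀, C w = A x₀ (Y x₀) w) :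
    lieBracket I X Y x₀ ∈ E x₀ ∧ ∀ W, IsSection I F W →
      curvature D X Y W x₀ = 0 ∧
      B (cov D Y W x₀) - C (cov D X W x₀)
        + cderiv I (fun y => A y (Y y) (W y)) x₀ (X x₀)
        - cderiv I (fun y => A y (X y) (W y)) x₀ (Y x₀)
        - A x₀ (lieBracket I X Y x₀) (W x₀) = 0 := by
  obtain ⟨X', ξ, hX', hXX', hξ, rfl, hξA⟩ := exists_adapted_functional hF hA hX hB
  obtain ⟨Y', η, hY', hYY', hη, rfl, hηA⟩ := exists_adapted_functional hF hA hY hC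
  have hin : ∀ {X : Π x : M, ComplexTangentSpace I x}
      {ξ : Π x : M, ComplexTangentSpace I x →ₗ[ℂ] ℂ}, IsSection I E X →
      (∀ x, ∀ w ∈ F x, ξ x w = A x (X x) w) → ∀ γ, InLift D E F A γ (lift D X ξ γ) := by
    intro X ξ hX hξA γ
    refine ⟨by rw [projC_lift]; exact hX.mem _, fun w hw => ?_⟩
    rw [pairing_vertC_lift, projC_lift, hξA _ _ hw]
  have hbr := hinvol _ _ (csmoothAt_lift hD hX'.csmoothAt hξ) (csmoothAt_lift hD hY'.csmoothAt hη)
    (hin hX' hξA) (hin hY' hηA)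
  have hlie : lieBracket I X' Y' x₀ = lieBracket I X Y x₀ :=
    lieBracket_congr hXX' hYY'
  have hproj : ∀ γ : CotangentBundle I M, _ := fun γ =>
    projC_lieBracket_lift hD hX'.csmoothAt hξ hY'.csmoothAt hη γ
  refine ⟨?_, fun W hW => ?_⟩
  -- Any point of the fibre over `x₀` would do.
  · have h1 := (hbr (⟨x₀, (0 : CotangentSpace I x₀)⟩ : CotangentBundle I M)).1
    rw [hproj] at h1
    rwa [← hlie]
  have hWs := hW.csmoothAt
  have e1 : ∀ {X X' Y Y' : Π x : M, ComplexTangentSpace I x}, (∀ᶠ x in 𝓝 x₀, X' x = X x) →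
      (∀ᶠ x in 𝓝 x₀, Y' x = Y x) → (∀ x, CSmoothAt Y x) → (∀ x, CSmoothAt Y' x) →
      cov D X' (cov D Y' W) x₀ = cov D X (cov D Y W) x₀ := by
    intro X X' Y Y' hX hY hYs hYs'
    rw [cov_eq, cov_eq, hX.self_of_nhds, covAt_congr ((hYs' x₀).cov hD hW.smooth)
      ((hYs x₀).cov hD hW.smooth)]
    filter_upwards [hY] with y hy
    rw [cov_eq, cov_eq, hy]
  have e2 : ∀ {X X' Y : Π x : M, ComplexTangentSpace I x}
      {ξ : Π x : M, ComplexTangentSpace I x →ₗ[ℂ] ℂ}, (∀ᶠ x in 𝓝 x₀, X' x = X x) →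
      (∀ x, ∀ w ∈ F x, ξ x w = A x (X' x) w) →
      cderiv I (fun y => ξ y (W y)) x₀ = cderiv I (fun y => A y (X y) (W y)) x₀ := by
    intro X X' Y ξ h hξA
    refine cderiv_congr ?_
    filter_upwards [h] with y hy
    rw [hξA _ _ (hW.mem y), hy]
  -- The left side is linear in `p` and the right side does not involve `p`. Taking `p = 0` kills
  -- the right side, and then every `p` annihilates the curvature.
  have key : ∀ p : CotangentSpace I x₀, evalC p (curvature D X Y W x₀) =
      ξ x₀ (cov D Y W x₀) - η x₀ (cov D X W x₀)
        + cderiv I (fun y => A y (Y y) (W y)) x₀ (X x₀)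
        - cderiv I (fun y => A y (X y) (W y)) x₀ (Y x₀)
        - A x₀ (lieBracket I X Y x₀) (W x₀) := by
    intro p
    have h1 := (hbr (⟨x₀, p⟩ : CotangentBundle I M)).cderiv_momentum hW
    rw [cderiv_momentum_lieBracket_lift hD hX'.csmoothAt hξ hY'.csmoothAt hη hW.smooth,
      hproj] at h1
    simp only [hlie, e1 hXX' hYY' hY.csmoothAt hY'.csmoothAt,
      e1 hYY' hXX' hX.csmoothAt hX'.csmoothAt, e2 (Y := X) hYY' hηA, e2 (Y := X) hXX' hξA] at h1
    simp only [cov_eq D Y', cov_eq D X', hXX'.self_of_nhds, hYY'.self_of_nhds] at h1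
    simp only [curvature, cov_eq D Y, cov_eq D X, cov_eq D (lieBracket I X Y), map_add, map_neg,
      map_sub] at h1 ⊢
    linear_combination -h1
  have h0 := key 0
  have hz : evalC (0 : CotangentSpace I x₀) (curvature D X Y W x₀) = 0 := by
    rw [evalC_apply]
    simp
  rw [hz] at h0
  exact ⟨eq_zero_of_evalC fun p => (key p).trans h0.symm, h0.symm⟩

omit [FiniteDimensional ℝ V] [IsManifold I ∞ M] [T2Space M] [I.Boundaryless] in
theorem mem_of_forall_functional {x : M} {S : Submodule ℂ (ComplexTangentSpace I x)}
    {z : ComplexTangentSpace I x}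
    (h : ∀ B : ComplexTangentSpace I x →ₗ[ℂ] ℂ, (∀ w ∈ S, B w = 0) → B z = 0) : z ∈ S := by
  by_contra hz
  obtain ⟨B, hB, hS⟩ := Submodule.exists_le_ker_of_notMem hz
  exact hB (h B fun w hw => LinearMap.mem_ker.1 (hS hw))

/-- The covector attached to `X` is constrained only on `F`. Changing it by a functional `B` that
vanishes on `F` changes the structure equation by `B (D_X W)`, so every annihilator of `F` kills
`D_X W`. -/
theorem cov_mem_of_involutive (hD : D.ContMDiffCovariantDerivative ∞)
    (hF : IsSubbundle I F)
    (hA : ∀ Y W, IsSection I E Y → IsSection I F W →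
      ∀ x, ContMDiffAt I 𝓘(ℝ, ℂ) ∞ (fun y => A y (Y y) (W y)) x)
    (hinvol : ∀ Z Z' : Π γ : CotangentBundle I M, ComplexTangentSpace (cotModel I) γ,
      (∀ γ, CSmoothAt Z γ) → (∀ γ, CSmoothAt Z' γ) →
      (∀ γ, InLift D E F A γ (Z γ)) → (∀ γ, InLift D E F A γ (Z' γ)) →
      ∀ γ, InLift D E F A γ (lieBracket (cotModel I) Z Z' γ))
    {X W : Π x : M, ComplexTangentSpace I x} (hX : IsSection I E X) (hW : IsSection I F W) :
    IsSection I F (cov D X W) := by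
  refine ⟨smoothOn_univ_iff.2 fun x => (hX.csmoothAt x).cov hD hW.smooth, fun x => ?_⟩
  refine mem_of_forall_functional fun B hB => ?_
  -- The choice `Y = X` suffices: only the difference between the two covectors `A(X, ·)` and `A(X,
  -- ·) + B` matters.
  have h1 := ((structure_equations_of_involutive hD hF hA hinvol hX hX (x₀ := x)
    (B := A x (X x)) (C := A x (X x)) (fun _ _ => rfl) (fun _ _ => rfl)).2 W hW).2
  have h2 := ((structure_equations_of_involutive hD hF hA hinvol hX hX (x₀ := x)
    (B := A x (X x) + B) (C := A x (X x))
    (fun w hw => by rw [LinearMap.add_apply, hB w hw, add_zero]) (fun _ _ => rfl)).2 W hW).2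
  rw [LinearMap.add_apply] at h2
  linear_combination h2 - h1

/-- A distribution lifted to the cotangent manifold is involutive if and only if the structure
equations hold. -/
theorem involutive_inLift_iff (hD : D.ContMDiffCovariantDerivative ∞)
    (hE : IsSubbundle I E) (hF : IsSubbundle I F)
    (hA : ∀ Y W, IsSection I E Y → IsSection I F W →
      ∀ x, ContMDiffAt I 𝓘(ℝ, ℂ) ∞ (fun y => A y (Y y) (W y)) x) :
    (∀ Z Z' : Π γ : CotangentBundle I M, ComplexTangentSpace (cotModel I) γ,
      (∀ γ, CSmoothAt Z γ) → (∀ γ, CSmoothAt Z' γ) →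
      (∀ γ, InLift D E F A γ (Z γ)) → (∀ γ, InLift D E F A γ (Z' γ)) →
      ∀ γ, InLift D E F A γ (lieBracket (cotModel I) Z Z' γ)) ↔
    IsInvolutive I E ∧
    ((∀ X W, IsSection I E X → IsSection I F W → IsSection I F (cov D X W)) ∧
      ∀ X Y W, IsSection I E X → IsSection I E Y → IsSection I F W →
        ∀ x, curvature D X Y W x = 0) ∧
    ∀ X Y W, IsSection I E X → IsSection I E Y → IsSection I F W → ∀ x,
      covForm D A X Y W x - covForm D A Y X W x + A x (torsion D X Y x) (W x) = 0 := by
  constructor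
  · intro h
    have key := fun {X Y : Π x : M, ComplexTangentSpace I x} (hX : IsSection I E X)
      (hY : IsSection I E Y) (x : M) => structure_equations_of_involutive hD hF hA h hX hY
        (x₀ := x) (B := A x (X x)) (C := A x (Y x)) (fun _ _ => rfl) (fun _ _ => rfl)
    refine ⟨fun X Y hX hY x => (key hX hY x).1,
      ⟨fun X W hX hW => cov_mem_of_involutive hD hF hA h hX hW,
        fun X Y W hX hY hW x => ((key hX hY x).2 W hW).1⟩, fun X Y W hX hY hW x => ?_⟩
    rw [covForm_identity]
    linear_combination ((key hX hY x).2 W hW).2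
  · rintro ⟨hinv, ⟨hcov, hcurv⟩, htors⟩ Z Z' hZ hZ' hZL hZL' γ
    exact inLift_lieBracket hE hF hA hinv hcov hcurv htors hZ hZ' hZL hZL' γ

end Necessity

/-! ### The subbundle `τ(E)` and its sections -/

section Conjugation

variable {W : Type*} [AddCommGroup W] [Module ℝ W]

@[simp] theorem tau_tau (t : Parity) (z : ℂ ⊗[ℝ] W) : tau t (tau t z) = z := by
  cases t
  · exact cconj_cconj z
  · rfl

theorem tau_mem_of_mem_tauImage (t : Parity) {E : Submodule ℂ (ℂ ⊗[ℝ] W)} {z : ℂ ⊗[ℝ] W}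
    (hz : z ∈ tauImage t E) : tau t z ∈ E := by
  cases t
  · obtain ⟨w, hw, rfl⟩ := hz
    change cconj (cconj w) ∈ E
    rwa [cconj_cconj]
  · exact hz

theorem linearIndependent_cconj {r : ℕ} {e : Fin r → ℂ ⊗[ℝ] W} (he : LinearIndependent ℂ e) :
    LinearIndependent ℂ fun i => cconj (e i) := by
  rw [Fintype.linearIndependent_iff] at he ⊢
  intro g hg i
  have h1 := he (fun i => starRingEnd ℂ (g i)) (by
    have h2 := congrArg cconj hg
    simpa [map_sum, map_smulₛₗ] using h2) i
  simpa using h1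

variable {V : Type*} [NormedAddCommGroup V] [NormedSpace ℝ V]
  {H : Type*} [TopologicalSpace H] {I : ModelWithCorners ℝ V H}
  {M : Type*} [TopologicalSpace M] [ChartedSpace H M] [IsManifold I 1 M]
  {E : Π x : M, Submodule ℂ (ComplexTangentSpace I x)}

theorem SmoothOn.tau (t : Parity) {Z : Π x : M, ComplexTangentSpace I x} {U : Set M}
    (hZ : SmoothOn I Z U) : SmoothOn I (fun x => tau t (Z x)) U := by
  cases t
  · refine ⟨?_, ?_⟩
    · simpa only [CotangentGC.tau, cre_cconj] using hZ.1
    · simp only [CotangentGC.tau, cim_cconj]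
      exact hZ.2.neg_section
  · exact hZ

theorem IsSubbundle.tauImage (t : Parity) (hE : IsSubbundle I E) :
    IsSubbundle I fun x => tauImage t (E x) := by
  intro x₀
  obtain ⟨U, hU, hx₀, r, Z, hZ, hspan⟩ := hE x₀
  refine ⟨U, hU, hx₀, r, fun i x => CotangentGC.tau t (Z i x), fun i => (hZ i).tau t,
    fun x hx => ?_⟩
  cases t
  · refine ⟨linearIndependent_cconj (hspan x hx).1, ?_⟩
    change Submodule.span ℂ (Set.range fun i => cconj (Z i x)) = (E x).map cconj
    rw [← (hspan x hx).2, Submodule.map_span, ← Set.range_comp]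
    rfl
  · exact hspan x hx

theorem IsSection.tau (t : Parity) {Z : Π x : M, ComplexTangentSpace I x} (hZ : IsSection I E Z) :
    IsSection I (fun x => CotangentGC.tauImage t (E x)) fun x => CotangentGC.tau t (Z x) :=
  ⟨hZ.smooth.tau t, fun x => tau_mem_tauImage t (hZ.mem x)⟩

theorem IsSection.of_tauImage (t : Parity) {Z : Π x : M, ComplexTangentSpace I x}
    (hZ : IsSection I (fun x => CotangentGC.tauImage t (E x)) Z) :
    IsSection I E fun x => CotangentGC.tau t (Z x) :=
  ⟨hZ.smooth.tau t, fun x => tau_mem_of_mem_tauImage t (hZ.mem x)⟩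

end Conjugation

/-- Project onto `F` along a complement in the second argument, then extend the resulting map from
`E` to `S`. No smooth choice is required, since smoothness is used only for values on sections of
`E` and `F`. -/
theorem exists_bilinear_extension {S : Type*} [AddCommGroup S] [Module ℂ S] {E F : Submodule ℂ S}
    (a : E →ₗ[ℂ] F →ₗ[ℂ] ℂ) :
    ∃ A : S →ₗ[ℂ] S →ₗ[ℂ] ℂ, ∀ (X : E) (W : F), A X W = a X W := by
  obtain ⟨p, hp⟩ := F.exists_isCompl
  obtain ⟨q, hq⟩ := LinearMap.exists_extend (LinearMap.lcomp ℂ ℂ (F.projectionOnto p hp) ∘ₗ a)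
  refine ⟨q, fun X W => ?_⟩
  have h1 : q X = LinearMap.lcomp ℂ ℂ (F.projectionOnto p hp) (a X) := LinearMap.congr_fun hq X
  rw [h1, LinearMap.lcomp_apply, Submodule.projectionOnto_apply_left]

/-! ### The theorem for a fixed extension of `α`, and for all of them -/

section Integrability

variable {V : Type*} [NormedAddCommGroup V] [NormedSpace ℝ V] [FiniteDimensional ℝ V]
  {H : Type*} [TopologicalSpace H] {I : ModelWithCorners ℝ V H} [I.Boundaryless]
  {M : Type*} [TopologicalSpace M] [ChartedSpace H M] [IsManifold I ∞ M] [T2Space M]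
  {t : Parity}
  {𝒥 : Π x : M, GenTangentSpace I x →L[ℝ] GenTangentSpace I x}
  {D : CovariantDerivative I V (TangentSpace I : M → Type _)}
  {E : Π x : M, Submodule ℂ (ComplexTangentSpace I x)}
  {α : Π x : M, E x →ₗ[ℂ] tauImage t (E x) →ₗ[ℂ] ℂ}
  {A : Π x : M, ComplexTangentSpace I x →ₗ[ℂ] ComplexTangentSpace I x →ₗ[ℂ] ℂ}

/-- Integrability does not mention `A`. Hence the three conditions together hold for one extension
of `α` iff they hold for every extension. -/
theorem isIntegrable_inducedACS_iff (hD : D.ContMDiffCovariantDerivative ∞)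
    (hE : IsSubbundle I E) (hα : IsSmoothForm t E α)
    (hL : ∀ x : M, (holomorphicSpace (𝒥 x).toLinearMap : Set _) = Ltau t (E x) (α x))
    (hA : ∀ (x : M) (X : E x) (W : tauImage t (E x)), A x X W = α x X W) :
    IsIntegrable (cotModel I) (inducedACS 𝒥 D) ↔
    IsInvolutive I E ∧
    ((∀ X W, IsSection I E X → IsSection I (fun x => tauImage t (E x)) W →
        IsSection I (fun x => tauImage t (E x)) (cov D X W)) ∧
      ∀ X Y W, IsSection I E X → IsSection I E Y →
        IsSection I (fun x => tauImage t (E x)) W → ∀ x, curvature D X Y W x = 0) ∧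
    ∀ X Y W, IsSection I E X → IsSection I E Y →
      IsSection I (fun x => tauImage t (E x)) W → ∀ x,
      covForm D A X Y W x - covForm D A Y X W x + A x (torsion D X Y x) (W x) = 0 := by
  have hAs : ∀ Y W, IsSection I E Y → IsSection I (fun x => tauImage t (E x)) W →
      ∀ x, ContMDiffAt I 𝓘(ℝ, ℂ) ∞ (fun y => A y (Y y) (W y)) x := by
    intro Y W hY hW x
    refine (hα Y W hY hW).contMDiffAt.congr_of_eventuallyEq (Filter.Eventually.of_forall fun y => ?_)
    exact hA y ⟨Y y, hY.mem y⟩ ⟨W y, hW.mem y⟩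
  have hmem : ∀ γ z, z ∈ holomorphicSpace (inducedACS 𝒥 D γ) ↔
      InLift D E (fun x => tauImage t (E x)) A γ z := by
    refine mem_holomorphicSpace_inducedACS (𝒥 := 𝒥) (E := E) (F := fun x => tauImage t (E x))
      (A := A) D fun x l => ?_
    rw [← SetLike.mem_coe, hL]
    constructor
    · rintro ⟨h, hw⟩
      exact ⟨h, fun w hwF => (hw ⟨w, hwF⟩).trans (hA x ⟨_, h⟩ ⟨w, hwF⟩).symm⟩
    · rintro ⟨h, hw⟩
      exact ⟨h, fun W => (hw W W.2).trans (hA x ⟨_, h⟩ W)⟩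
  rw [← involutive_inLift_iff hD hE (hE.tauImage t) hAs]
  constructor
  · intro h Z Z' hZ hZ' hZL hZL' γ
    exact (hmem γ _).1 (h Z Z' ⟨smoothOn_univ_iff.2 hZ, fun γ => (hmem γ _).2 (hZL γ)⟩
      ⟨smoothOn_univ_iff.2 hZ', fun γ => (hmem γ _).2 (hZL' γ)⟩ γ)
  · intro h Z Z' hZ hZ' γ
    exact (hmem γ _).2 (h Z Z' hZ.csmoothAt hZ'.csmoothAt (fun γ => (hmem γ _).1 (hZ.mem γ))
      (fun γ => (hmem γ _).1 (hZ'.mem γ)) γ)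

end Integrability

end CotangentGC

end

theorem theorem3p2
    {V : Type*} [NormedAddCommGroup V] [NormedSpace ℝ V] [FiniteDimensional ℝ V]
    {H : Type*} [TopologicalSpace H] (I : ModelWithCorners ℝ V H) [I.Boundaryless]
    {M : Type*} [TopologicalSpace M] [ChartedSpace H M] [IsManifold I ∞ M] [T2Space M]
    (t : CotangentGC.Parity)
    (𝒥 : Π x : M, CotangentGC.GenTangentSpace I x →L[ℝ] CotangentGC.GenTangentSpace I x)
    (h𝒥 : CotangentGC.IsGenComplex t 𝒥)
    (D : CovariantDerivative I V (TangentSpace I : M → Type _))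
    (hD : D.ContMDiffCovariantDerivative ∞)
    (E : Π x : M, Submodule ℂ (CotangentGC.ComplexTangentSpace I x))
    (hE : CotangentGC.IsSubbundle I E)
    (α : Π x : M, E x →ₗ[ℂ] CotangentGC.tauImage t (E x) →ₗ[ℂ] ℂ)
    (hα : CotangentGC.IsSmoothForm t E α)
    (hL : ∀ x : M, (CotangentGC.holomorphicSpace (𝒥 x).toLinearMap : Set _) =
      CotangentGC.Ltau t (E x) (α x)) :
    CotangentGC.IsIntegrable (CotangentGC.cotModel I) (CotangentGC.inducedACS 𝒥 D) ↔
      CotangentGC.IsInvolutive I E ∧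
      ((∀ X W : Π x : M, CotangentGC.ComplexTangentSpace I x, CotangentGC.IsSection I E X →
          CotangentGC.IsSection I (fun x => CotangentGC.tauImage t (E x)) W →
          CotangentGC.IsSection I (fun x => CotangentGC.tauImage t (E x))
            (CotangentGC.cov D X W)) ∧
        (∀ X Y W : Π x : M, CotangentGC.ComplexTangentSpace I x, CotangentGC.IsSection I E X →
          CotangentGC.IsSection I E Y →
          CotangentGC.IsSection I (fun x => CotangentGC.tauImage t (E x)) W →
          ∀ x : M, CotangentGC.curvature D X Y W x = 0)) ∧
      CotangentGC.TorsionEquation t D E α := by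
  choose A hA using fun x => CotangentGC.exists_bilinear_extension (α x)
  constructor
  · intro h
    obtain ⟨h1, h2, -⟩ := (CotangentGC.isIntegrable_inducedACS_iff hD hE hα hL hA).1 h
    -- Conditions (i) and (ii) do not involve the extension, so the chosen `A` serves for them;
    -- (iii) is read off for each `A'` separately.
    refine ⟨h1, h2, fun A' hA' X Y Z hX hY hZ x => ?_⟩
    exact ((CotangentGC.isIntegrable_inducedACS_iff hD hE hα hL hA').1 h).2.2 X Y _ hX hY
      (hZ.tau t) x
  · rintro ⟨h1, h2, h3⟩
    refine (CotangentGC.isIntegrable_inducedACS_iff hD hE hα hL hA).2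
      ⟨h1, h2, fun X Y W hX hY hW x => ?_⟩
    -- A section `W` of `τ(E)` is `τ` of the section `τ W` of `E`, because `τ` is an involution.
    simpa using h3 A hA X Y _ hX hY (hW.of_tauImage t) x
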